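/- Let $\nu>0$ and put, for $x\in\mathbb R$, $$u_\nu(x)=\frac{1}{(1+x^2)^{\nu}},\qquad V_\nu(x)=-\frac{2}{\sqrt\pi}\,\frac{\Gamma(\frac12+\nu)}{\Gamma(\nu)}\,(1+x^2)^{\nu}\;{}_2F_1\!\left(1,\tfrac12+\nu;\tfrac12;-x^2\right),$$ where ${}_2F_1(a,b;c;\cdot)$ denotes, on $(-\infty,1)$, the real-analytic continuation of the Gauss hypergeometric series. Then $$\sqrt{-\frac{d^2}{dx^2}}\,u_\nu+V_\nu u_\nu=0$$ in the distributional sense, that is, for every Schwartz function $\varphi$ on $\mathbb R$, $$\int_{\mathbb R}u_\nu\,\sqrt{-\tfrac{d^2}{dx^2}}\,\varphi\,dx+\int_{\mathbb R}V_\nu u_\nu\,\varphi\,dx=0,$$ both integrals being absolutely convergent, where $\sqrt{-d^2/dx^2}$ acts on $\varphi$ as the Fourier multiplier $|k|$. Moreover, as $|x|\to\infty$: (1) if $0<\nu<\frac12$, then $V_\nu(x)=O(1/|x|)$; (2) if $\nu=\frac12$, then $u_{1/2}(x)=\frac{1}{\sqrt{1+x^2}}$, $$V_{1/2}(x)=-\frac{2}{\pi}\left(\frac{1}{\sqrt{1+x^2}}-\frac{|x|\,\mathrm{arcsinh}|x|}{1+x^2}\right),$$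 and $V_{1/2}(x)=O(\log|x|/|x|)$; (3) if $\frac12<\nu<1$, then $V_\nu(x)=O(1/|x|^{2-2\nu})$. -/

import Mathlib

open MeasureTheory Filter Asymptotics
open scoped FourierTransform SchwartzMap Topology

/-- `F` is the analytic continuation to `(-∞, 1)` of the Gauss hypergeometric series with
parameters `a, b; c`: it is real analytic on `(-∞, 1)` and equals the sum of the series on
`(-1, 1)`. This is the restriction to the real half-line of the principal branch. -/
def IsGaussContinuation (a b c : ℝ) (F : ℝ → ℝ) : Prop :=
  AnalyticOnNhd ℝ F (Set.Iio 1) ∧ ∀ x : ℝ, |x| < 1 → F x = ordinaryHypergeometric a b c x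

/-- The analytic continuation is unique on `(-∞, 1)`. -/
theorem IsGaussContinuation.eqOn {a b c : ℝ} {F G : ℝ → ℝ} (hF : IsGaussContinuation a b c F)
    (hG : IsGaussContinuation a b c G) : Set.EqOn F G (Set.Iio 1) := by
  refine hF.1.eqOn_of_preconnected_of_eventuallyEq hG.1 (convex_Iio 1).isPreconnected
    (z₀ := 0) (by simp) ?_
  filter_upwards [Metric.ball_mem_nhds (0 : ℝ) one_pos] with x hx
  have hx' : |x| < 1 := by simpa [Real.dist_eq] using hx
  rw [hF.2 x hx', hG.2 x hx']

open Classical in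
/-- The Gauss hypergeometric function `₂F₁(a, b; c; x)` for real `x < 1`: the value at `x` of the
(unique) analytic continuation of the hypergeometric series to `(-∞, 1)`. -/
noncomputable def gaussHG (a b c x : ℝ) : ℝ :=
  if h : ∃ F : ℝ → ℝ, IsGaussContinuation a b c F then Classical.choose h x else 0

/-- `gaussHG` may be computed through any function that continues the series. -/
theorem IsGaussContinuation.gaussHG_eq {a b c : ℝ} {F : ℝ → ℝ} (hF : IsGaussContinuation a b c F)
    {x : ℝ} (hx : x < 1) : gaussHG a b c x = F x := by
  have h : ∃ F : ℝ → ℝ, IsGaussContinuation a b c F := ⟨F, hF⟩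
  rw [gaussHG, dif_pos h]
  exact (Classical.choose_spec h).eqOn hF hx

/-- `u_ν(x) = (1 + x²)^(-ν)`. -/
noncomputable def uFun (ν x : ℝ) : ℝ := 1 / (1 + x ^ 2) ^ ν

/-- `V_ν(x) = -(2/√π) (Γ(1/2 + ν)/Γ(ν)) (1 + x²)^ν ₂F₁(1, 1/2 + ν; 1/2; -x²)`. -/
noncomputable def VFun (ν x : ℝ) : ℝ :=
  -(2 / √Real.pi) * (Real.Gamma (1 / 2 + ν) / Real.Gamma ν) * (1 + x ^ 2) ^ ν *
    gaussHG 1 (1 / 2 + ν) (1 / 2) (-x ^ 2)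

/-- `√(-d²/dx²)` on Schwartz functions: the Fourier multiplier `|k|`. With Mathlib's
normalisation of the Fourier transform (kernel `exp(-2πixξ)`) the frequency is `k = 2πξ`. -/
noncomputable def sqrtNegLaplacian (φ : 𝓢(ℝ, ℂ)) : ℝ → ℂ :=
  𝓕⁻ (fun ξ : ℝ => ((2 * Real.pi * |ξ| : ℝ) : ℂ) * 𝓕 (φ : ℝ → ℂ) ξ)

/-- `√(-d²/dx²) u + V u = 0` in the distributional sense. The distribution `√(-d²/dx²) u` acts on
a test function `φ` as `∫ u √(-d²/dx²) φ`, since `√(-d²/dx²)` is symmetric. All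
integrals involved are required to converge absolutely. -/
def IsZeroEnergySolution (V u : ℝ → ℝ) : Prop :=
  ∀ φ : 𝓢(ℝ, ℂ),
    Integrable (fun x : ℝ => (u x : ℂ) * sqrtNegLaplacian φ x) ∧
    Integrable (fun x : ℝ => ((V x * u x : ℝ) : ℂ) * φ x) ∧
    (∫ x : ℝ, (u x : ℂ) * sqrtNegLaplacian φ x) +
      (∫ x : ℝ, ((V x * u x : ℝ) : ℂ) * φ x) = 0

/-! The function `u_ν` is a superposition of Gaussians: `Γ(ν) u_ν(x) = ∫₀^∞ t^(ν-1) e^(-t) e^(-tx²)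
dt`. On a single Gaussian, `√(-d²/dx²)` is explicit: it gives `(2√t/√π)(1 - 2tx² ∫₀¹ exp(-tx²(1-s²))
ds)`, a Dawson-type function (`gaussianKernel`). Integrating this against `t^(ν-1) e^(-t)` turns
every `t`-integral into a Gamma integral. With `b = 1/2 + ν` the result is `(2/√π) Γ(b) (1 - 2bx²
∫₀¹ (1 + x²(1-s²))^(-b-1) ds)`. The bracket is `eulerIntegral b (-x²)`, which is `₂F₁(1, b; 1/2;
-x²)` by comparison of power series and analytic continuation; so the result is `-Γ(ν) V_ν u_ν`.

Tested against a Schwartz function, the argument needs Fubini twice. This rests on the integrability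
of `√(-d²/dx²) φ`, which is `O(1/x²)` despite the kink of `|k|`, and on `|gaussianKernel t x| ≤
2√t/√π`, uniformly in `x`. The Gaussian identity itself is moved onto `φ` by
`integral_fourier_mul_eq_integral_mul_fourier`.

For the decay, the two terms of `eulerIntegral` nearly cancel at infinity.
`eulerIntegral_neg_sq_eq_rpow_sub` makes the cancellation explicit and leaves `(1+x²)^(-b)` plus an
error controlled by `∫₀¹ (1 + x²r)^(-b) dr`. That integral is elementary, and the cases `b < 1`, `b
= 1`, `b > 1` are the three regimes of the theorem. -/

/-- `1 + 2by ∫₀¹ (1 - y(1 - s²))^(-b-1) ds`, an integral representation of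
`₂F₁(1, b; 1/2; y)` valid for all `y < 1`. -/
noncomputable def eulerIntegral (b y : ℝ) : ℝ :=
  1 + 2 * b * y * ∫ s in (0 : ℝ)..1, (1 - y * (1 - s ^ 2)) ^ (-(b + 1))

/-! ### Analytic continuation of the hypergeometric series -/

theorem one_sub_mul_pos {y s : ℝ} (hy : y < 1) (hs : s ∈ Set.Icc (0 : ℝ) 1) :
    0 < 1 - y * (1 - s ^ 2) := by
  have h1 : 0 ≤ 1 - s ^ 2 := by nlinarith [hs.1, hs.2]
  have h2 : 1 - s ^ 2 ≤ 1 := by nlinarith [hs.1, hs.2]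
  rcases le_or_gt y 0 with h | h
  · nlinarith
  · nlinarith

theorem re_one_sub_mul_ge {z : ℂ} {r s : ℝ} (hr : 0 < r) (hr1 : r < 1) (hz : z.re < r)
    (hs : s ∈ Set.Icc (0 : ℝ) 1) : 1 - r ≤ (1 - z * ((1 - s ^ 2 : ℝ) : ℂ)).re := by
  have h1 : 0 ≤ 1 - s ^ 2 := by nlinarith [hs.1, hs.2]
  have h2 : 1 - s ^ 2 ≤ 1 := by nlinarith [hs.1, hs.2]
  have : (1 - z * ((1 - s ^ 2 : ℝ) : ℂ)).re = 1 - z.re * (1 - s ^ 2) := by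
    rw [Complex.sub_re, Complex.re_mul_ofReal, Complex.one_re]
  rw [this]
  nlinarith

/-- Differentiation under the integral: near `z₀` the base has real part at least `1 - r > 0`, so it
stays in the slit plane and the derivative is dominated by a constant. -/
theorem differentiableOn_integral_one_sub_mul_cpow (c : ℝ) (hc : 0 ≤ c) :
    DifferentiableOn ℂ
      (fun z : ℂ => ∫ s in (0 : ℝ)..1, (1 - z * ((1 - s ^ 2 : ℝ) : ℂ)) ^ (-c : ℂ))
      {z | z.re < 1} := by
  intro z₀ hz₀
  apply DifferentiableAt.differentiableWithinAt
  obtain ⟨r, hr, hr1⟩ := exists_between (max_lt (show z₀.re < 1 from hz₀) zero_lt_one)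
  have hr0 : 0 < r := (le_max_right _ _).trans_lt hr
  have hzr : z₀.re < r := (le_max_left _ _).trans_lt hr
  have hopen : {z : ℂ | z.re < r} ∈ 𝓝 z₀ :=
    (isOpen_lt Complex.continuous_re continuous_const).mem_nhds hzr
  have hsub : Set.uIoc (0 : ℝ) 1 ⊆ Set.Icc 0 1 := by
    rw [Set.uIoc_of_le zero_le_one]; exact Set.Ioc_subset_Icc_self
  have hslit : ∀ z : ℂ, z.re < r → ∀ s ∈ Set.Icc (0 : ℝ) 1,
      (1 - z * ((1 - s ^ 2 : ℝ) : ℂ)) ∈ Complex.slitPlane := fun z hz s hs =>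
    Or.inl (lt_of_lt_of_le (by linarith) (re_one_sub_mul_ge hr0 hr1 hz hs))
  have hcont : ∀ (e : ℂ) (z : ℂ), z.re < r →
      ContinuousOn (fun s : ℝ => (1 - z * ((1 - s ^ 2 : ℝ) : ℂ)) ^ e) (Set.uIcc 0 1) := by
    intro e z hz
    rw [Set.uIcc_of_le zero_le_one]
    refine ContinuousOn.cpow_const (by fun_prop) fun s hs => hslit z hz s hs
  let F' : ℂ → ℝ → ℂ := fun z s =>
    (-c : ℂ) * (1 - z * ((1 - s ^ 2 : ℝ) : ℂ)) ^ (-c - 1 : ℂ) * (-((1 - s ^ 2 : ℝ) : ℂ))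
  have hF'c : ContinuousOn (F' z₀) (Set.uIcc 0 1) :=
    (continuousOn_const.mul (hcont _ z₀ hzr)).mul (by fun_prop)
  refine (intervalIntegral.hasDerivAt_integral_of_dominated_loc_of_deriv_le
    (F' := F') (bound := fun _ => c * (1 - r) ^ (-c - 1)) hopen ?_ ?_ ?_ ?_ ?_ ?_).2.differentiableAt
  · filter_upwards [hopen] with z hz
    exact ((hcont _ z hz).intervalIntegrable).def'.1
  · exact (hcont _ z₀ hzr).intervalIntegrable
  · exact hF'c.intervalIntegrable.def'.1
  · refine Eventually.of_forall fun s hs z hz => ?_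
    have hs' := hsub hs
    have hge := re_one_sub_mul_ge hr0 hr1 hz hs'
    have hnorm : ‖(1 - z * ((1 - s ^ 2 : ℝ) : ℂ)) ^ (-c - 1 : ℂ)‖ ≤ (1 - r) ^ (-c - 1) := by
      have : (-c - 1 : ℂ) = ((-c - 1 : ℝ) : ℂ) := by push_cast; rfl
      rw [this, Complex.norm_cpow_real]
      exact Real.rpow_le_rpow_of_nonpos (by linarith)
        (hge.trans (Complex.re_le_norm _)) (by linarith)
    have h1 : ‖(-((1 - s ^ 2 : ℝ) : ℂ))‖ ≤ 1 := by
      rw [norm_neg, Complex.norm_real, Real.norm_eq_abs, abs_le]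
      constructor <;> nlinarith [hs'.1, hs'.2]
    have h2 : ‖(-c : ℂ)‖ = c := by
      rw [norm_neg, Complex.norm_real, Real.norm_of_nonneg hc]
    calc ‖F' z s‖ = c * ‖(1 - z * ((1 - s ^ 2 : ℝ) : ℂ)) ^ (-c - 1 : ℂ)‖ *
          ‖(-((1 - s ^ 2 : ℝ) : ℂ))‖ := by simp only [F', norm_mul, h2]
      _ ≤ c * (1 - r) ^ (-c - 1) * 1 := by gcongr
      _ = _ := mul_one _
  · exact intervalIntegrable_const
  · refine Eventually.of_forall fun s hs z hz => ?_
    have h : HasDerivAt (fun z : ℂ => 1 - z * ((1 - s ^ 2 : ℝ) : ℂ)) (-((1 - s ^ 2 : ℝ) : ℂ)) z := by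
      convert! ((hasDerivAt_id z).mul_const ((1 - s ^ 2 : ℝ) : ℂ)).const_sub 1 using 1
      rw [one_mul]
    exact h.cpow_const (hslit z hz s (hsub hs))

theorem analyticOnNhd_eulerIntegral {b : ℝ} (hb : 0 ≤ b) :
    AnalyticOnNhd ℝ (eulerIntegral b) (Set.Iio 1) := by
  intro y hy
  have hopen : IsOpen {z : ℂ | z.re < 1} := isOpen_lt Complex.continuous_re continuous_const
  have h1 := (differentiableOn_integral_one_sub_mul_cpow (b + 1) (by linarith)).analyticAt
    (hopen.mem_nhds (show ((y : ℂ)).re < 1 by simpa using hy))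
  have h2 := h1.re_ofReal
  have h3 : AnalyticAt ℝ (fun y : ℝ => ∫ s in (0 : ℝ)..1, (1 - y * (1 - s ^ 2)) ^ (-(b + 1))) y := by
    refine h2.congr ?_
    filter_upwards [isOpen_Iio.mem_nhds hy] with x hx
    have : (∫ s in (0 : ℝ)..1, (1 - (x : ℂ) * ((1 - s ^ 2 : ℝ) : ℂ)) ^ (-((b + 1 : ℝ)) : ℂ)) =
        ((∫ s in (0 : ℝ)..1, (1 - x * (1 - s ^ 2)) ^ (-(b + 1)) : ℝ) : ℂ) := by
      rw [← intervalIntegral.integral_ofReal]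
      refine intervalIntegral.integral_congr fun s hs => ?_
      rw [Set.uIcc_of_le zero_le_one] at hs
      have := (one_sub_mul_pos hx hs).le
      rw [Complex.ofReal_cpow this]
      push_cast
      rfl
    rw [this, Complex.ofReal_re]
  exact analyticAt_const.add ((analyticAt_const.mul analyticAt_id).mul h3)

/-- `∫₀¹ (1 - s²)ⁿ ds = n! / (3/2)ₙ`. -/
theorem integral_one_sub_sq_pow (n : ℕ) :
    (∫ s in (0 : ℝ)..1, (1 - s ^ 2) ^ n) * (ascPochhammer ℝ n).eval (3 / 2) = n.factorial := by
  induction n with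
  | zero => simp
  | succ n ih =>
    -- Integrate the derivative of `s(1 - s²)^(n+1)`, which vanishes at both endpoints.
    have hrec : (2 * n + 3 : ℝ) * (∫ s in (0 : ℝ)..1, (1 - s ^ 2) ^ (n + 1)) =
        (2 * n + 2) * ∫ s in (0 : ℝ)..1, (1 - s ^ 2) ^ n := by
      have hd : ∀ s ∈ Set.uIcc (0 : ℝ) 1, HasDerivAt (fun s : ℝ => s * (1 - s ^ 2) ^ (n + 1))
          ((2 * n + 3) * (1 - s ^ 2) ^ (n + 1) - (2 * n + 2) * (1 - s ^ 2) ^ n) s := by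
        intro s _
        have h : HasDerivAt (fun s : ℝ => 1 - s ^ 2) (-(2 * s)) s := by
          simpa using (hasDerivAt_pow 2 s).const_sub 1
        refine ((hasDerivAt_id s).mul (h.pow (n + 1))).congr_deriv ?_
        simp only [id, Pi.pow_apply, Nat.add_sub_cancel, pow_succ]
        push_cast
        ring
      have := intervalIntegral.integral_eq_sub_of_hasDerivAt hd
        (Continuous.intervalIntegrable (by fun_prop) _ _)
      rw [intervalIntegral.integral_sub (Continuous.intervalIntegrable (by fun_prop) _ _)
        (Continuous.intervalIntegrable (by fun_prop) _ _), intervalIntegral.integral_const_mul,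
        intervalIntegral.integral_const_mul] at this
      simp at this
      linarith
    rw [ascPochhammer_succ_eval, Nat.factorial_succ]
    push_cast
    rw [← ih]
    linear_combination (Polynomial.eval (3 / 2) (ascPochhammer ℝ n)) / 2 * hrec

theorem hasSum_one_sub_rpow_neg (a : ℝ) {x : ℝ} (hx : |x| < 1) :
    HasSum (fun n : ℕ => (ascPochhammer ℝ n).eval a / n.factorial * x ^ n) ((1 - x) ^ (-a)) := by
  have h := (Real.one_div_one_sub_rpow_hasFPowerSeriesOnBall_zero a).hasSum (y := x)
    (by simpa [enorm_eq_nnnorm, ← NNReal.coe_lt_coe] using hx)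
  have hpos : 0 ≤ 1 - x := by linarith [le_abs_self x]
  simp only [zero_add, FormalMultilinearSeries.ofScalars_apply_eq] at h
  rw [Real.rpow_neg hpos, ← one_div]
  refine h.congr_fun fun n => ?_
  rw [smul_eq_mul]
  congr 1
  have := Ring.factorial_nsmul_multichoose_eq_ascPochhammer a n
  rw [div_eq_iff (by positivity), Ring.choose, show a + n - 1 - n + 1 = a by ring,
    ← Polynomial.ascPochhammer_smeval_eq_eval, ← this]
  simp [mul_comm]

/-- The binomial series is integrated term by term; `∫₀¹ (1 - s²)ⁿ ds` replaces `n!` by `(3/2)ₙ` in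
the denominator. Since `a > 0` the coefficients are nonnegative, and the series at `|y|` dominates.
-/
theorem hasSum_integral_one_sub_mul_rpow {a y : ℝ} (ha : 0 < a) (hy : |y| < 1) :
    HasSum (fun n : ℕ => (ascPochhammer ℝ n).eval a * ((ascPochhammer ℝ n).eval (3 / 2))⁻¹ * y ^ n)
      (∫ s in (0 : ℝ)..1, (1 - y * (1 - s ^ 2)) ^ (-a)) := by
  have hcoef : ∀ n : ℕ, 0 ≤ (ascPochhammer ℝ n).eval a / n.factorial := fun n =>
    div_nonneg (ascPochhammer_pos n a ha).le (by positivity)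
  have hsub : Set.uIoc (0 : ℝ) 1 ⊆ Set.Icc 0 1 := by
    rw [Set.uIoc_of_le zero_le_one]; exact Set.Ioc_subset_Icc_self
  have habs : ∀ s ∈ Set.uIoc (0 : ℝ) 1, |y * (1 - s ^ 2)| ≤ |y| := fun s hs => by
    have hs' := hsub hs
    rw [abs_mul]
    refine mul_le_of_le_one_right (abs_nonneg _) ?_
    rw [abs_le]
    constructor <;> nlinarith [hs'.1, hs'.2]
  have hsum := hasSum_one_sub_rpow_neg a (x := |y|) (by rwa [abs_abs])
  have h := intervalIntegral.hasSum_integral_of_dominated_convergence (μ := volume)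
    (a := 0) (b := 1)
    (F := fun n s => (ascPochhammer ℝ n).eval a / n.factorial * (y * (1 - s ^ 2)) ^ n)
    (f := fun s => (1 - y * (1 - s ^ 2)) ^ (-a))
    (fun n _ => (ascPochhammer ℝ n).eval a / n.factorial * |y| ^ n)
    (fun n => Continuous.aestronglyMeasurable (by fun_prop))
    (fun n => Eventually.of_forall fun s hs => ?_)
    (Eventually.of_forall fun s _ => hsum.summable) intervalIntegrable_const
    (Eventually.of_forall fun s hs =>
      hasSum_one_sub_rpow_neg a ((habs s hs).trans_lt hy))
  · refine h.congr_fun fun n => ?_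
    have hne : (ascPochhammer ℝ n).eval (3 / 2) ≠ 0 := (ascPochhammer_pos n _ (by norm_num)).ne'
    have : ∀ s : ℝ, (ascPochhammer ℝ n).eval a / n.factorial * (y * (1 - s ^ 2)) ^ n =
        ((ascPochhammer ℝ n).eval a / n.factorial * y ^ n) * (1 - s ^ 2) ^ n := fun s => by
      rw [mul_pow]; ring
    simp_rw [this]
    rw [intervalIntegral.integral_const_mul, eq_div_of_mul_eq hne (integral_one_sub_sq_pow n)]
    field_simp
  · rw [norm_mul, Real.norm_of_nonneg (hcoef n), norm_pow, Real.norm_eq_abs]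
    exact mul_le_mul_of_nonneg_left (pow_le_pow_left₀ (abs_nonneg _) (habs s hs) n) (hcoef n)

theorem ascPochhammer_eval_succ_eq_mul (n : ℕ) (b : ℝ) :
    (ascPochhammer ℝ (n + 1)).eval b = b * (ascPochhammer ℝ n).eval (b + 1) := by
  simp [ascPochhammer_succ_left]

/-- Since `(1)ₙ = n!`, `(b)ₙ₊₁ = b (b+1)ₙ` and `(1/2)ₙ₊₁ = (1/2)(3/2)ₙ`, the terms beyond the
constant one are `2by` times the series for exponent `b + 1`. -/
theorem isGaussContinuation_eulerIntegral {b : ℝ} (hb : 0 < b) :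
    IsGaussContinuation 1 b (1 / 2) (eulerIntegral b) := by
  refine ⟨analyticOnNhd_eulerIntegral hb.le, fun y hy => ?_⟩
  have h := (hasSum_integral_one_sub_mul_rpow (a := b + 1) (by linarith) hy).mul_left (2 * b * y)
  have h' : HasSum (fun n : ℕ => ((n.factorial : ℝ)⁻¹ * (ascPochhammer ℝ n).eval 1 *
      (ascPochhammer ℝ n).eval b * ((ascPochhammer ℝ n).eval (1 / 2))⁻¹) • y ^ n)
      (eulerIntegral b y) := by
    rw [← hasSum_nat_add_iff' 1]
    have he : eulerIntegral b y - ∑ n ∈ Finset.range 1, ((n.factorial : ℝ)⁻¹ *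
        (ascPochhammer ℝ n).eval 1 * (ascPochhammer ℝ n).eval b *
        ((ascPochhammer ℝ n).eval (1 / 2))⁻¹) • y ^ n =
        2 * b * y * ∫ s in (0 : ℝ)..1, (1 - y * (1 - s ^ 2)) ^ (-(b + 1)) := by
      simp [eulerIntegral]
    rw [he]
    refine h.congr_fun fun n => ?_
    have hne : (ascPochhammer ℝ n).eval (3 / 2) ≠ 0 := (ascPochhammer_pos n _ (by norm_num)).ne'
    have hf : ((n + 1).factorial : ℝ) ≠ 0 := by positivity
    rw [ascPochhammer_eval_one, ascPochhammer_eval_succ_eq_mul, ascPochhammer_eval_succ_eq_mul,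
      show (1 / 2 + 1 : ℝ) = 3 / 2 by norm_num, smul_eq_mul, pow_succ]
    field_simp
  rw [ordinaryHypergeometric_eq_tsum]
  exact h'.tsum_eq.symm

theorem gaussHG_eq_eulerIntegral {b y : ℝ} (hb : 0 < b) (hy : y < 1) :
    gaussHG 1 b (1 / 2) y = eulerIntegral b y :=
  (isGaussContinuation_eulerIntegral hb).gaussHG_eq hy

/-! ### Bounds for the Euler integral at `-x²` -/

theorem one_add_mul_pos {x s : ℝ} (hs : s ∈ Set.Icc (0 : ℝ) 1) : 0 < 1 + x ^ 2 * (1 - s ^ 2) := by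
  have : 0 ≤ 1 - s ^ 2 := by nlinarith [hs.1, hs.2]
  positivity

theorem eulerIntegral_neg_sq (b x : ℝ) :
    eulerIntegral b (-x ^ 2) =
      1 - 2 * b * x ^ 2 * ∫ s in (0 : ℝ)..1, (1 + x ^ 2 * (1 - s ^ 2)) ^ (-(b + 1)) := by
  have : ∀ s : ℝ, 1 - -x ^ 2 * (1 - s ^ 2) = 1 + x ^ 2 * (1 - s ^ 2) := fun s => by ring
  simp only [eulerIntegral, this]
  ring

theorem continuousOn_one_add_mul_rpow (x e : ℝ) :
    ContinuousOn (fun s : ℝ => (1 + x ^ 2 * (1 - s ^ 2)) ^ e) (Set.uIcc 0 1) := by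
  rw [Set.uIcc_of_le zero_le_one]
  exact ContinuousOn.rpow_const (by fun_prop) fun s hs => Or.inl (one_add_mul_pos hs).ne'

theorem integral_two_mul_mul_one_add_mul_rpow (b x : ℝ) :
    (∫ s in (0 : ℝ)..1, 2 * b * x ^ 2 * (s * (1 + x ^ 2 * (1 - s ^ 2)) ^ (-(b + 1)))) =
      1 - (1 + x ^ 2) ^ (-b) := by
  have hd : ∀ s ∈ Set.uIcc (0 : ℝ) 1, HasDerivAt (fun s : ℝ => (1 + x ^ 2 * (1 - s ^ 2)) ^ (-b))
      (2 * b * x ^ 2 * (s * (1 + x ^ 2 * (1 - s ^ 2)) ^ (-(b + 1)))) s := by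
    intro s hs
    rw [Set.uIcc_of_le zero_le_one] at hs
    have h : HasDerivAt (fun s : ℝ => 1 + x ^ 2 * (1 - s ^ 2)) (x ^ 2 * -(2 * s)) s := by
      simpa using (((hasDerivAt_pow 2 s).const_sub 1).const_mul (x ^ 2)).const_add 1
    refine (h.rpow_const (p := -b) (Or.inl (one_add_mul_pos hs).ne')).congr_deriv ?_
    rw [show -b - 1 = -(b + 1) by ring]
    ring
  rw [intervalIntegral.integral_eq_sub_of_hasDerivAt hd]
  · norm_num
  · exact (continuousOn_const.mul (continuousOn_id.mul
      (continuousOn_one_add_mul_rpow x _))).intervalIntegrable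

/-- For large `|x|` the integral concentrates near `s = 1`, where it cancels the constant `1`.
Subtracting the exactly integrable version with an extra factor `s` leaves the factor `1 - s`, which
vanishes there. -/
theorem eulerIntegral_neg_sq_eq_rpow_sub (b x : ℝ) :
    eulerIntegral b (-x ^ 2) = (1 + x ^ 2) ^ (-b) -
      2 * b * (x ^ 2 * ∫ s in (0 : ℝ)..1, (1 - s) * (1 + x ^ 2 * (1 - s ^ 2)) ^ (-(b + 1))) := by
  have h := integral_two_mul_mul_one_add_mul_rpow b x
  have hc := continuousOn_one_add_mul_rpow x (-(b + 1))
  rw [intervalIntegral.integral_const_mul] at h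
  have : (∫ s in (0 : ℝ)..1, (1 - s) * (1 + x ^ 2 * (1 - s ^ 2)) ^ (-(b + 1))) =
      (∫ s in (0 : ℝ)..1, (1 + x ^ 2 * (1 - s ^ 2)) ^ (-(b + 1))) -
      ∫ s in (0 : ℝ)..1, s * (1 + x ^ 2 * (1 - s ^ 2)) ^ (-(b + 1)) := by
    have hsc : ContinuousOn (fun s : ℝ => s * (1 + x ^ 2 * (1 - s ^ 2)) ^ (-(b + 1)))
      (Set.uIcc 0 1) := continuousOn_id.mul hc
    rw [← intervalIntegral.integral_sub hc.intervalIntegrable hsc.intervalIntegrable]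
    congr 1; ext s; ring
  rw [this, eulerIntegral_neg_sq]
  linear_combination (-1 : ℝ) * h

theorem continuousOn_one_add_sq_mul_rpow (x e : ℝ) :
    ContinuousOn (fun r : ℝ => (1 + x ^ 2 * r) ^ e) (Set.uIcc 0 1) := by
  rw [Set.uIcc_of_le zero_le_one]
  refine ContinuousOn.rpow_const (by fun_prop) fun r hr => Or.inl ?_
  have := hr.1
  positivity

/-- Since `1 - s² ≥ 1 - s`, the base may be lowered to `1 + x²(1 - s)`; this absorbs the factor
`x²(1 - s)` at the cost of one power. Then `r = 1 - s`. -/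
theorem sq_mul_integral_le {b : ℝ} (hb : 0 < b) (x : ℝ) :
    x ^ 2 * (∫ s in (0 : ℝ)..1, (1 - s) * (1 + x ^ 2 * (1 - s ^ 2)) ^ (-(b + 1))) ≤
      ∫ r in (0 : ℝ)..1, (1 + x ^ 2 * r) ^ (-b) := by
  have hflip : (∫ r in (0 : ℝ)..1, (1 + x ^ 2 * r) ^ (-b)) =
      ∫ s in (0 : ℝ)..1, (1 + x ^ 2 * (1 - s)) ^ (-b) := by
    simpa using (intervalIntegral.integral_comp_sub_left
      (fun r => (1 + x ^ 2 * r) ^ (-b)) (1 : ℝ) (a := 0) (b := 1)).symm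
  have hcf : ContinuousOn (fun s : ℝ => (1 + x ^ 2 * (1 - s)) ^ (-b)) (Set.uIcc 0 1) := by
    rw [Set.uIcc_of_le zero_le_one]
    refine ContinuousOn.rpow_const (by fun_prop) fun r hr => Or.inl ?_
    have : 0 ≤ 1 - r := by linarith [hr.2]
    positivity
  rw [hflip, ← intervalIntegral.integral_const_mul]
  refine intervalIntegral.integral_mono_on zero_le_one ?_ hcf.intervalIntegrable fun s hs => ?_
  · exact (continuousOn_const.mul ((continuousOn_const.sub continuousOn_id).mul
      (continuousOn_one_add_mul_rpow x _))).intervalIntegrable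
  · have h0 : 0 ≤ 1 - s := by linarith [hs.2]
    have h1 : 0 < 1 + x ^ 2 * (1 - s) := by positivity
    have h2 : 1 + x ^ 2 * (1 - s) ≤ 1 + x ^ 2 * (1 - s ^ 2) := by
      gcongr
      nlinarith [hs.1, hs.2]
    calc x ^ 2 * ((1 - s) * (1 + x ^ 2 * (1 - s ^ 2)) ^ (-(b + 1)))
        ≤ x ^ 2 * ((1 - s) * (1 + x ^ 2 * (1 - s)) ^ (-(b + 1))) := by
          have := Real.rpow_le_rpow_of_nonpos h1 h2 (show -(b + 1) ≤ 0 by linarith)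
          gcongr
      _ ≤ (1 + x ^ 2 * (1 - s)) * (1 + x ^ 2 * (1 - s)) ^ (-(b + 1)) := by
          rw [← mul_assoc]
          gcongr
          linarith
      _ = (1 + x ^ 2 * (1 - s)) ^ (-b) := by
          rw [show -b = 1 + -(b + 1) by ring, Real.rpow_add h1, Real.rpow_one]

theorem abs_eulerIntegral_neg_sq_le {b : ℝ} (hb : 0 < b) (x : ℝ) :
    |eulerIntegral b (-x ^ 2)| ≤
      (1 + x ^ 2) ^ (-b) + 2 * b * ∫ r in (0 : ℝ)..1, (1 + x ^ 2 * r) ^ (-b) := by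
  have h := sq_mul_integral_le hb x
  have h0 : 0 ≤ x ^ 2 *
      (∫ s in (0 : ℝ)..1, (1 - s) * (1 + x ^ 2 * (1 - s ^ 2)) ^ (-(b + 1))) := by
    refine mul_nonneg (sq_nonneg x) (intervalIntegral.integral_nonneg zero_le_one fun s hs => ?_)
    exact mul_nonneg (by linarith [hs.2]) (Real.rpow_nonneg (one_add_mul_pos hs).le _)
  have h1 : 0 ≤ (1 + x ^ 2) ^ (-b) := by positivity
  rw [eulerIntegral_neg_sq_eq_rpow_sub, abs_le]
  constructor <;> nlinarith

theorem integral_one_add_sq_mul_rpow_le_one {b : ℝ} (hb : 0 < b) (x : ℝ) :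
    (∫ r in (0 : ℝ)..1, (1 + x ^ 2 * r) ^ (-b)) ≤ 1 := by
  have := intervalIntegral.integral_mono_on (μ := volume) zero_le_one
    (continuousOn_one_add_sq_mul_rpow x (-b)).intervalIntegrable
    (intervalIntegrable_const (c := (1 : ℝ))) fun r hr => by
      have := hr.1
      exact Real.rpow_le_one_of_one_le_of_nonpos (by nlinarith [sq_nonneg x]) (by linarith)
  simpa using this

/-- As `V_ν u_ν` is a constant multiple of this function, the bound makes `V_ν u_ν φ` integrable. -/
theorem abs_eulerIntegral_neg_sq_le_const {b : ℝ} (hb : 0 < b) (x : ℝ) :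
    |eulerIntegral b (-x ^ 2)| ≤ 1 + 2 * b := by
  have h1 := abs_eulerIntegral_neg_sq_le hb x
  have h2 := integral_one_add_sq_mul_rpow_le_one hb x
  have h3 : (1 + x ^ 2) ^ (-b) ≤ 1 :=
    Real.rpow_le_one_of_one_le_of_nonpos (by nlinarith [sq_nonneg x]) (by linarith)
  nlinarith

theorem continuous_eulerIntegral_neg_sq {b : ℝ} (hb : 0 ≤ b) :
    Continuous fun x : ℝ => eulerIntegral b (-x ^ 2) :=
  (analyticOnNhd_eulerIntegral hb).continuousOn.comp_continuous (by fun_prop) fun x =>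
    show -x ^ 2 < 1 by nlinarith [sq_nonneg x]

theorem integral_one_add_sq_mul_rpow {b x : ℝ} (hb : b ≠ 1) (hx : x ≠ 0) :
    (∫ r in (0 : ℝ)..1, (1 + x ^ 2 * r) ^ (-b)) =
      ((1 + x ^ 2) ^ (1 - b) - 1) / ((1 - b) * x ^ 2) := by
  have hb' : 1 - b ≠ 0 := sub_ne_zero.mpr hb.symm
  have hd : ∀ r ∈ Set.uIcc (0 : ℝ) 1, HasDerivAt
      (fun r : ℝ => (1 + x ^ 2 * r) ^ (1 - b) / ((1 - b) * x ^ 2)) ((1 + x ^ 2 * r) ^ (-b)) r := by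
    intro r hr
    rw [Set.uIcc_of_le zero_le_one] at hr
    have hpos : 0 < 1 + x ^ 2 * r := by have := hr.1; positivity
    have h : HasDerivAt (fun r : ℝ => 1 + x ^ 2 * r) (x ^ 2) r := by
      simpa using ((hasDerivAt_id r).const_mul (x ^ 2)).const_add 1
    refine ((h.rpow_const (p := 1 - b) (Or.inl hpos.ne')).div_const _).congr_deriv ?_
    rw [show 1 - b - 1 = -b by ring]
    field_simp
  rw [intervalIntegral.integral_eq_sub_of_hasDerivAt hd
    (continuousOn_one_add_sq_mul_rpow x (-b)).intervalIntegrable]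
  simp [sub_div]

theorem integral_one_add_sq_mul_rpow_neg_one {x : ℝ} (hx : x ≠ 0) :
    (∫ r in (0 : ℝ)..1, (1 + x ^ 2 * r) ^ (-1 : ℝ)) = Real.log (1 + x ^ 2) / x ^ 2 := by
  have hd : ∀ r ∈ Set.uIcc (0 : ℝ) 1, HasDerivAt
      (fun r : ℝ => Real.log (1 + x ^ 2 * r) / x ^ 2) ((1 + x ^ 2 * r) ^ (-1 : ℝ)) r := by
    intro r hr
    rw [Set.uIcc_of_le zero_le_one] at hr
    have hpos : 0 < 1 + x ^ 2 * r := by have := hr.1; positivity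
    have h : HasDerivAt (fun r : ℝ => 1 + x ^ 2 * r) (x ^ 2) r := by
      simpa using ((hasDerivAt_id r).const_mul (x ^ 2)).const_add 1
    refine ((h.log hpos.ne').div_const _).congr_deriv ?_
    rw [Real.rpow_neg_one]
    field_simp
  rw [intervalIntegral.integral_eq_sub_of_hasDerivAt hd
    (continuousOn_one_add_sq_mul_rpow x (-1)).intervalIntegrable]
  simp

/-! ### Decay of the potential in the three regimes -/

theorem VFun_eq {ν : ℝ} (hν : 0 < ν) (x : ℝ) :
    VFun ν x = -(2 / √Real.pi) * (Real.Gamma (1 / 2 + ν) / Real.Gamma ν) * (1 + x ^ 2) ^ ν *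
      eulerIntegral (1 / 2 + ν) (-x ^ 2) := by
  rw [VFun, gaussHG_eq_eulerIntegral (by linarith) (by nlinarith [sq_nonneg x])]

/-- The decay of `VFun ν` is governed by `∫₀¹ (1 + x²r)^(-1/2-ν) dr`. -/
theorem exists_abs_VFun_le {ν : ℝ} (hν : 0 < ν) :
    ∃ C : ℝ, 0 ≤ C ∧ ∀ x : ℝ, x ≠ 0 → |VFun ν x| ≤ C * (1 / |x| +
      (1 + x ^ 2) ^ ν * ∫ r in (0 : ℝ)..1, (1 + x ^ 2 * r) ^ (-(1 / 2 + ν))) := by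
  have hb : 0 < 1 / 2 + ν := by linarith
  set K := |-(2 / √Real.pi) * (Real.Gamma (1 / 2 + ν) / Real.Gamma ν)|
  refine ⟨K * (1 + 2 * (1 / 2 + ν)), by positivity, fun x hx => ?_⟩
  set J := ∫ r in (0 : ℝ)..1, (1 + x ^ 2 * r) ^ (-(1 / 2 + ν))
  have hJ : 0 ≤ J := intervalIntegral.integral_nonneg zero_le_one fun r hr => by
    have := hr.1
    positivity
  have hx' : 0 < |x| := abs_pos.mpr hx
  have hp : 0 < 1 + x ^ 2 := by positivity
  -- The exponents add up to `-1/2` whatever `ν` is.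
  have h1 : (1 + x ^ 2) ^ ν * (1 + x ^ 2) ^ (-(1 / 2 + ν)) ≤ 1 / |x| := by
    rw [← Real.rpow_add hp, show ν + -(1 / 2 + ν) = -(1 / 2) by ring, Real.rpow_neg hp.le,
      ← Real.sqrt_eq_rpow, ← one_div]
    exact one_div_le_one_div_of_le hx' (Real.abs_le_sqrt (by linarith))
  have h2 : 0 ≤ 1 / |x| := by positivity
  have h3 : 0 ≤ (1 + x ^ 2) ^ ν := by positivity
  rw [VFun_eq hν, abs_mul, abs_mul, abs_of_nonneg h3, mul_assoc, mul_assoc]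
  refine mul_le_mul_of_nonneg_left ?_ (abs_nonneg _)
  calc (1 + x ^ 2) ^ ν * |eulerIntegral (1 / 2 + ν) (-x ^ 2)|
      ≤ (1 + x ^ 2) ^ ν * ((1 + x ^ 2) ^ (-(1 / 2 + ν)) + 2 * (1 / 2 + ν) * J) := by
        gcongr
        exact abs_eulerIntegral_neg_sq_le hb x
    _ = (1 + x ^ 2) ^ ν * (1 + x ^ 2) ^ (-(1 / 2 + ν)) +
        2 * (1 / 2 + ν) * ((1 + x ^ 2) ^ ν * J) := by ring
    _ ≤ 1 / |x| + 2 * (1 / 2 + ν) * ((1 + x ^ 2) ^ ν * J) := by gcongr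
    _ ≤ _ := by
        have : 0 ≤ (1 + x ^ 2) ^ ν * J := mul_nonneg h3 hJ
        nlinarith

/-- The threshold `|x| ≥ 2` and the factor `2` in `h1` suit the logarithmic case, where `2 log 2 ≥
1` is needed. -/
theorem isBigO_VFun_of_le {ν : ℝ} (hν : 0 < ν) {g : ℝ → ℝ} {c : ℝ}
    (h1 : ∀ x : ℝ, 2 ≤ |x| → 1 / |x| ≤ 2 * g x)
    (h2 : ∀ x : ℝ, 2 ≤ |x| →
      (1 + x ^ 2) ^ ν * (∫ r in (0 : ℝ)..1, (1 + x ^ 2 * r) ^ (-(1 / 2 + ν))) ≤ c * g x) :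
    VFun ν =O[cocompact ℝ] g := by
  obtain ⟨C, hC, h⟩ := exists_abs_VFun_le hν
  refine IsBigO.of_bound (C * (2 + c)) ?_
  filter_upwards [(tendsto_norm_cocompact_atTop (E := ℝ)).eventually_ge_atTop 2] with x hx
  have hx : 2 ≤ |x| := hx
  have hx0 : x ≠ 0 := abs_pos.mp (by linarith)
  have hg : 0 ≤ g x := by have := h1 x hx; have : 0 ≤ 1 / |x| := by positivity
                          linarith
  rw [Real.norm_eq_abs, Real.norm_of_nonneg hg, mul_assoc]
  refine (h x hx0).trans (mul_le_mul_of_nonneg_left ?_ hC)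
  linarith [h1 x hx, h2 x hx]

theorem sqrt_one_add_sq_le {x : ℝ} (hx : 2 ≤ |x|) : √(1 + x ^ 2) ≤ 2 * |x| := by
  rw [Real.sqrt_le_left (by positivity)]
  nlinarith [sq_abs x]

theorem isBigO_VFun_of_lt_half {ν : ℝ} (hν : 0 < ν) (hν' : ν < 1 / 2) :
    VFun ν =O[cocompact ℝ] fun x : ℝ => 1 / |x| := by
  have hpos : 0 < 1 - (1 / 2 + ν) := by linarith
  refine isBigO_VFun_of_le hν (c := 2 / (1 - (1 / 2 + ν))) (fun x hx => ?_) fun x hx => ?_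
  · have : 0 ≤ 1 / |x| := by positivity
    linarith
  · have hx0 : 0 < |x| := by linarith
    have hp : 0 < 1 + x ^ 2 := by positivity
    have hs := sqrt_one_add_sq_le hx
    rw [integral_one_add_sq_mul_rpow (by linarith) (abs_pos.mp hx0)]
    calc (1 + x ^ 2) ^ ν * (((1 + x ^ 2) ^ (1 - (1 / 2 + ν)) - 1) / ((1 - (1 / 2 + ν)) * x ^ 2))
        ≤ (1 + x ^ 2) ^ ν * ((1 + x ^ 2) ^ (1 - (1 / 2 + ν)) / ((1 - (1 / 2 + ν)) * x ^ 2)) := by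
          gcongr
          linarith
      _ = √(1 + x ^ 2) / ((1 - (1 / 2 + ν)) * x ^ 2) := by
          rw [mul_div_assoc', ← Real.rpow_add hp, Real.sqrt_eq_rpow]
          ring_nf
      _ ≤ 2 * |x| / ((1 - (1 / 2 + ν)) * x ^ 2) := by gcongr
      _ = _ := by
          rw [← sq_abs x]
          field_simp

theorem isBigO_VFun_half : VFun (1 / 2) =O[cocompact ℝ] fun x : ℝ => Real.log |x| / |x| := by
  refine isBigO_VFun_of_le (by norm_num) (c := 6) (fun x hx => ?_) fun x hx => ?_
  · have hx0 : 0 < |x| := by linarith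
    have : 1 / 2 ≤ Real.log |x| := by
      have := Real.log_le_log (by norm_num) hx
      linarith [Real.log_two_gt_d9]
    rw [mul_div_assoc']
    gcongr
    linarith
  · have hx0 : 0 < |x| := by linarith
    have hs := sqrt_one_add_sq_le hx
    have hl : Real.log (1 + x ^ 2) ≤ 3 * Real.log |x| := by
      have : 3 * Real.log |x| = Real.log (|x| ^ 3) := by rw [Real.log_pow]; norm_num
      rw [this]
      -- For `|x| ≥ 2` one has `1 + x² ≤ |x|³`.
      refine Real.log_le_log (by positivity) ?_
      rw [← sq_abs x]
      nlinarith [sq_nonneg |x|]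
    have hl0 : 0 ≤ Real.log |x| := Real.log_nonneg (by linarith)
    norm_num only
    rw [integral_one_add_sq_mul_rpow_neg_one (abs_pos.mp hx0), ← Real.sqrt_eq_rpow]
    calc √(1 + x ^ 2) * (Real.log (1 + x ^ 2) / x ^ 2)
        ≤ (2 * |x|) * (3 * Real.log |x| / x ^ 2) := by
          have : 0 ≤ Real.log (1 + x ^ 2) := Real.log_nonneg (by nlinarith [sq_nonneg x])
          gcongr
      _ = _ := by
          rw [← sq_abs x]
          generalize Real.log |x| = l
          field_simp
          ring

theorem isBigO_VFun_of_half_lt {ν : ℝ} (hν : 1 / 2 < ν) :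
    VFun ν =O[cocompact ℝ] fun x : ℝ => 1 / |x| ^ (2 - 2 * ν) := by
  have hpos : 0 < (1 / 2 + ν) - 1 := by linarith
  refine isBigO_VFun_of_le (by linarith) (c := 2 ^ ν / (1 / 2 + ν - 1)) (fun x hx => ?_)
    fun x hx => ?_
  · have h1 : |x| ^ (2 - 2 * ν) ≤ |x| := by
      conv_rhs => rw [← Real.rpow_one |x|]
      exact Real.rpow_le_rpow_of_exponent_le (by linarith) (by linarith)
    have hx0 : 0 < |x| := by linarith
    have h2 : 1 / |x| ≤ 1 / |x| ^ (2 - 2 * ν) :=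
      one_div_le_one_div_of_le (by positivity) h1
    have h3 : 0 ≤ 1 / |x| := by positivity
    linarith
  · have hx0 : 0 < |x| := by linarith
    have hp : 0 < 1 + x ^ 2 := by positivity
    rw [integral_one_add_sq_mul_rpow (by linarith) (abs_pos.mp hx0)]
    have e1 : ((1 + x ^ 2) ^ (1 - (1 / 2 + ν)) - 1) / ((1 - (1 / 2 + ν)) * x ^ 2) ≤
        1 / ((1 / 2 + ν - 1) * x ^ 2) := by
      rw [← neg_div_neg_eq, ← neg_mul, neg_sub, neg_sub]
      gcongr
      have : 0 ≤ (1 + x ^ 2) ^ (1 - (1 / 2 + ν)) := by positivity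
      linarith
    -- The constant comes from `1 + x² ≤ 2x²`.
    have e2 : (1 + x ^ 2) ^ ν ≤ 2 ^ ν * |x| ^ (2 * ν) := by
      rw [Real.rpow_mul hx0.le, ← Real.mul_rpow (by norm_num) (by positivity)]
      refine Real.rpow_le_rpow hp.le ?_ (by linarith)
      rw [Real.rpow_two, sq_abs]
      nlinarith [sq_abs x]
    calc _ ≤ 2 ^ ν * |x| ^ (2 * ν) * (1 / ((1 / 2 + ν - 1) * x ^ 2)) :=
          (mul_le_mul_of_nonneg_left e1 (by positivity)).trans
            (mul_le_mul_of_nonneg_right e2 (by positivity))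
      _ = _ := by
          rw [Real.rpow_sub hx0, Real.rpow_two, sq_abs]
          field_simp

/-! ### Closed form for `ν = 1/2` -/

theorem eulerIntegral_one_neg_sq (x : ℝ) :
    eulerIntegral 1 (-x ^ 2) =
      1 / (1 + x ^ 2) - x * Real.arsinh x / ((1 + x ^ 2) * √(1 + x ^ 2)) := by
  set A := 1 + x ^ 2 with hA
  have hA0 : 0 < A := by positivity
  have hB : ∀ s : ℝ, 1 + x ^ 2 * (1 - s ^ 2) = A - x ^ 2 * s ^ 2 := fun s => by rw [hA]; ring
  -- An explicit primitive of `x (A - x²s²)^(-2)`. The factor `x` avoids dividing by `x` and so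
  -- includes `x = 0`; at `s = 1` the quantity `A - x²s²` equals `1`.
  have hd : ∀ s ∈ Set.uIcc (0 : ℝ) 1, HasDerivAt
      (fun s : ℝ => x * s / (2 * A * (A - x ^ 2 * s ^ 2)) +
        Real.arsinh (x * s / √(A - x ^ 2 * s ^ 2)) / (2 * A * √A))
      (x * (1 + x ^ 2 * (1 - s ^ 2)) ^ (-(1 + 1) : ℝ)) s := by
    intro s hs
    rw [Set.uIcc_of_le zero_le_one] at hs
    have hpos := one_add_mul_pos (x := x) hs
    rw [hB] at hpos ⊢
    set B := A - x ^ 2 * s ^ 2 with hBdef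
    have hBd : HasDerivAt (fun s : ℝ => A - x ^ 2 * s ^ 2) (-(x ^ 2 * (2 * s))) s := by
      simpa using ((hasDerivAt_pow 2 s).const_mul (x ^ 2)).const_sub A
    have hxs : HasDerivAt (fun s : ℝ => x * s) x s := by
      simpa using (hasDerivAt_id s).const_mul x
    have hsq : √B ^ 2 = B := Real.sq_sqrt hpos.le
    have hsB : 0 < √B := Real.sqrt_pos.mpr hpos
    have hsA : 0 < √A := Real.sqrt_pos.mpr hA0
    have hsqA : √A ^ 2 = A := Real.sq_sqrt hA0.le
    have h1 := hxs.div (hBd.const_mul (2 * A)) (by positivity)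
    have h2 := ((hxs.div (hBd.sqrt hpos.ne') hsB.ne').arsinh).div_const (2 * A * √A)
    have hroot : √(1 + (x * s / √B) ^ 2) = √A / √B := by
      rw [← Real.sqrt_div hA0.le, div_pow, hsq]
      congr 1
      field_simp
      rw [hBdef]; ring
    refine (h1.add h2).congr_deriv ?_
    simp only [Pi.div_apply, ← hBdef, hroot]
    rw [show (-(1 + 1) : ℝ) = -((2 : ℕ) : ℝ) by norm_num, Real.rpow_neg hpos.le, Real.rpow_natCast]
    have hrel : x ^ 2 * s ^ 2 = √A ^ 2 - √B ^ 2 := by rw [hsq, hsqA, hBdef]; ring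
    generalize √A = a at *
    generalize √B = β at *
    rw [← hsq, ← hsqA, smul_eq_mul]
    field_simp
    linear_combination x * (2 * a ^ 2 + β ^ 2) * hrel
  have hint := intervalIntegral.integral_eq_sub_of_hasDerivAt hd
    (continuousOn_const.mul (continuousOn_one_add_mul_rpow x _)).intervalIntegrable
  rw [intervalIntegral.integral_const_mul] at hint
  have hA1 : A - x ^ 2 = 1 := by rw [hA]; ring
  simp [hA1] at hint
  have : eulerIntegral 1 (-x ^ 2) = 1 - 2 * x *
      (x * ∫ s in (0 : ℝ)..1, (1 + x ^ 2 * (1 - s ^ 2)) ^ (-(1 + 1) : ℝ)) := by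
    rw [eulerIntegral_neg_sq]; ring
  rw [this, show (-(1 + 1) : ℝ) = -1 + -1 by ring, hint]
  field_simp
  rw [hA]
  ring

theorem uFun_half (x : ℝ) : uFun (1 / 2) x = 1 / √(1 + x ^ 2) := by
  rw [uFun, Real.sqrt_eq_rpow]

theorem VFun_half (x : ℝ) :
    VFun (1 / 2) x =
      -(2 / Real.pi) * (1 / √(1 + x ^ 2) - |x| * Real.arsinh |x| / (1 + x ^ 2)) := by
  have hp : 0 < 1 + x ^ 2 := by positivity
  have hs : √(1 + x ^ 2) ^ 2 = 1 + x ^ 2 := Real.sq_sqrt hp.le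
  have hs0 : 0 < √(1 + x ^ 2) := Real.sqrt_pos.mpr hp
  have hpi : √Real.pi ^ 2 = Real.pi := Real.sq_sqrt Real.pi_pos.le
  have hpi0 : 0 < √Real.pi := Real.sqrt_pos.mpr Real.pi_pos
  have h := eulerIntegral_one_neg_sq |x|
  rw [sq_abs] at h
  rw [VFun_eq (by norm_num), show (1 / 2 + 1 / 2 : ℝ) = 1 by norm_num, h, Real.Gamma_one,
    Real.Gamma_one_half_eq, ← Real.sqrt_eq_rpow]
  generalize Real.arsinh |x| = l
  generalize |x| = y
  generalize √(1 + x ^ 2) = r at *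
  generalize √Real.pi = p at *
  rw [← hs, ← hpi]
  field_simp

/-! ### The Fourier transform of `|ξ| exp(-aξ²)` -/

/-- The integrand is the derivative of `-exp(-aξ²) cos(wξ)`. As the cosine integral is the
`w`-derivative of the sine integral `S`, this is the linear equation `2aS' + wS = 1`. -/
theorem integral_Ioi_mul_exp_neg_mul_sq_mul_cos {a : ℝ} (ha : 0 < a) (w : ℝ) :
    2 * a * (∫ ξ in Set.Ioi (0 : ℝ), ξ * Real.exp (-a * ξ ^ 2) * Real.cos (w * ξ)) +
      w * (∫ ξ in Set.Ioi (0 : ℝ), Real.exp (-a * ξ ^ 2) * Real.sin (w * ξ)) = 1 := by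
  have hc : Integrable fun ξ : ℝ => ξ * Real.exp (-a * ξ ^ 2) * Real.cos (w * ξ) :=
    (integrable_mul_exp_neg_mul_sq ha).mul_bdd (c := 1) (by fun_prop)
      (Eventually.of_forall fun ξ => Real.abs_cos_le_one _)
  have hs : Integrable fun ξ : ℝ => Real.exp (-a * ξ ^ 2) * Real.sin (w * ξ) :=
    (integrable_exp_neg_mul_sq ha).mul_bdd (c := 1) (by fun_prop)
      (Eventually.of_forall fun ξ => Real.abs_sin_le_one _)
  have hd : ∀ ξ ∈ Set.Ici (0 : ℝ), HasDerivAt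
      (fun ξ : ℝ => -(Real.exp (-a * ξ ^ 2) * Real.cos (w * ξ)))
      (2 * a * (ξ * Real.exp (-a * ξ ^ 2) * Real.cos (w * ξ)) +
        w * (Real.exp (-a * ξ ^ 2) * Real.sin (w * ξ))) ξ := by
    intro ξ _
    have h1 : HasDerivAt (fun ξ : ℝ => -a * ξ ^ 2) (-a * (2 * ξ)) ξ := by
      simpa using (hasDerivAt_pow 2 ξ).const_mul (-a)
    have h2 : HasDerivAt (fun ξ : ℝ => w * ξ) w ξ := by
      simpa using (hasDerivAt_id ξ).const_mul w
    refine (h1.exp.mul h2.cos).neg.congr_deriv ?_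
    ring
  have hint : Integrable fun ξ : ℝ => 2 * a * (ξ * Real.exp (-a * ξ ^ 2) * Real.cos (w * ξ)) +
        w * (Real.exp (-a * ξ ^ 2) * Real.sin (w * ξ)) := (hc.const_mul _).add (hs.const_mul _)
  have hlim : Tendsto (fun ξ : ℝ => -(Real.exp (-a * ξ ^ 2) * Real.cos (w * ξ))) atTop (𝓝 0) := by
    have h : Tendsto (fun ξ : ℝ => Real.exp (-a * ξ ^ 2)) atTop (𝓝 0) := by
      refine Real.tendsto_exp_atBot.comp ?_
      exact (tendsto_pow_atTop two_ne_zero).const_mul_atTop_of_neg (by linarith)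
    refine squeeze_zero_norm (fun ξ => ?_) h
    rw [norm_neg, norm_mul, Real.norm_of_nonneg (Real.exp_pos _).le]
    exact mul_le_of_le_one_right (Real.exp_pos _).le (Real.abs_cos_le_one _)
  have h := integral_Ioi_of_hasDerivAt_of_tendsto' hd hint.integrableOn hlim
  rw [integral_add (hc.const_mul _).integrableOn (hs.const_mul _).integrableOn,
    integral_const_mul, integral_const_mul] at h
  rw [h]
  simp

theorem hasDerivAt_integral_Ioi_exp_neg_mul_sq_mul_sin {a : ℝ} (ha : 0 < a) (w : ℝ) :
    HasDerivAt (fun w => ∫ ξ in Set.Ioi (0 : ℝ), Real.exp (-a * ξ ^ 2) * Real.sin (w * ξ))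
      (∫ ξ in Set.Ioi (0 : ℝ), ξ * Real.exp (-a * ξ ^ 2) * Real.cos (w * ξ)) w := by
  refine (hasDerivAt_integral_of_dominated_loc_of_deriv_le (s := Set.univ)
    (F := fun w ξ => Real.exp (-a * ξ ^ 2) * Real.sin (w * ξ))
    (F' := fun w ξ => ξ * Real.exp (-a * ξ ^ 2) * Real.cos (w * ξ))
    (bound := fun ξ => ‖ξ * Real.exp (-a * ξ ^ 2)‖) univ_mem ?_ ?_ ?_ ?_ ?_ ?_).2
  · exact Eventually.of_forall fun w => Continuous.aestronglyMeasurable (by fun_prop)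
  · exact ((integrable_exp_neg_mul_sq ha).mul_bdd (c := 1) (by fun_prop)
      (Eventually.of_forall fun ξ => Real.abs_sin_le_one _)).integrableOn
  · exact Continuous.aestronglyMeasurable (by fun_prop)
  · refine Eventually.of_forall fun ξ w _ => ?_
    rw [norm_mul]
    exact mul_le_of_le_one_right (norm_nonneg _) (Real.abs_cos_le_one _)
  · exact (integrable_mul_exp_neg_mul_sq ha).norm.integrableOn
  · refine Eventually.of_forall fun ξ w _ => ?_
    have h2 : HasDerivAt (fun w : ℝ => w * ξ) ξ w := by
      simpa using (hasDerivAt_id w).mul_const ξ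
    refine (h2.sin.const_mul _).congr_deriv ?_
    ring

/-- Solves `2aS' + wS = 1`, `S(0) = 0` with the integrating factor `exp(w²/(4a))`; the substitution
`y = sw` then normalises the interval to `[0, 1]`. -/
theorem integral_Ioi_exp_neg_mul_sq_mul_sin {a : ℝ} (ha : 0 < a) (w : ℝ) :
    (∫ ξ in Set.Ioi (0 : ℝ), Real.exp (-a * ξ ^ 2) * Real.sin (w * ξ)) =
      w / (2 * a) * ∫ s in (0 : ℝ)..1, Real.exp (-(w ^ 2 / (4 * a) * (1 - s ^ 2))) := by
  set S : ℝ → ℝ := fun w => ∫ ξ in Set.Ioi (0 : ℝ), Real.exp (-a * ξ ^ 2) * Real.sin (w * ξ)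
  have hd : ∀ y ∈ Set.uIcc 0 w, HasDerivAt (fun y => Real.exp (y ^ 2 / (4 * a)) * S y)
      (Real.exp (y ^ 2 / (4 * a)) / (2 * a)) y := by
    intro y _
    have h1 : HasDerivAt (fun y : ℝ => y ^ 2 / (4 * a)) (2 * y / (4 * a)) y := by
      simpa using (hasDerivAt_pow 2 y).div_const (4 * a)
    refine (h1.exp.mul (hasDerivAt_integral_Ioi_exp_neg_mul_sq_mul_sin ha y)).congr_deriv ?_
    have h := integral_Ioi_mul_exp_neg_mul_sq_mul_cos ha y
    change _ * _ * S y + _ = _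
    simp only [S]
    generalize (∫ ξ in Set.Ioi (0 : ℝ), ξ * Real.exp (-a * ξ ^ 2) * Real.cos (y * ξ)) = c at *
    generalize (∫ ξ in Set.Ioi (0 : ℝ), Real.exp (-a * ξ ^ 2) * Real.sin (y * ξ)) = d at *
    generalize Real.exp (y ^ 2 / (4 * a)) = e
    field_simp
    linear_combination 4 * e * h
  have h := intervalIntegral.integral_eq_sub_of_hasDerivAt hd
    (Continuous.intervalIntegrable (by fun_prop) _ _)
  have h0 : S 0 = 0 := by simp [S]
  rw [h0, mul_zero, sub_zero] at h
  have hscale : (∫ y in (0 : ℝ)..w, Real.exp (y ^ 2 / (4 * a)) / (2 * a)) =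
      w * ∫ s in (0 : ℝ)..1, Real.exp ((s * w) ^ 2 / (4 * a)) / (2 * a) := by
    simpa using (intervalIntegral.smul_integral_comp_mul_right
      (fun y => Real.exp (y ^ 2 / (4 * a)) / (2 * a)) w (a := 0) (b := 1)).symm
  have hS : S w = Real.exp (-(w ^ 2 / (4 * a))) *
      (w * ∫ s in (0 : ℝ)..1, Real.exp ((s * w) ^ 2 / (4 * a)) / (2 * a)) := by
    rw [← hscale, h, ← mul_assoc, ← Real.exp_add]
    simp
  change S w = _
  rw [hS, mul_left_comm, ← intervalIntegral.integral_const_mul,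
    ← intervalIntegral.integral_const_mul, ← intervalIntegral.integral_const_mul]
  congr 1
  ext s
  rw [mul_div_assoc', ← Real.exp_add]
  have : -(w ^ 2 / (4 * a)) + (s * w) ^ 2 / (4 * a) = -(w ^ 2 / (4 * a) * (1 - s ^ 2)) := by ring
  rw [this]
  ring

theorem integral_eq_zero_of_odd {f : ℝ → ℝ} (hf : ∀ x, f (-x) = -f x) : ∫ x, f x = 0 := by
  have h := integral_neg_eq_self f volume
  simp only [hf, integral_neg] at h
  linarith

/-- The Fourier transform of `|ξ| exp (-aξ²)`. -/
theorem fourier_abs_mul_exp_neg_mul_sq {a : ℝ} (ha : 0 < a) (x : ℝ) :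
    𝓕 (fun ξ : ℝ => ((|ξ| * Real.exp (-a * ξ ^ 2) : ℝ) : ℂ)) x =
      ((1 / a * (1 - 2 * (Real.pi ^ 2 * x ^ 2 / a) *
        ∫ s in (0 : ℝ)..1, Real.exp (-(Real.pi ^ 2 * x ^ 2 / a * (1 - s ^ 2)))) : ℝ) : ℂ) := by
  have habs : Integrable fun ξ : ℝ => |ξ| * Real.exp (-a * ξ ^ 2) := by
    refine (integrable_mul_exp_neg_mul_sq ha).norm.congr (Eventually.of_forall fun ξ => ?_)
    simp
  set w := 2 * Real.pi * x with hw
  have hci : Integrable fun ξ : ℝ => |ξ| * Real.exp (-a * ξ ^ 2) * Real.cos (w * ξ) :=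
    habs.mul_bdd (c := 1) (by fun_prop) (Eventually.of_forall fun ξ => Real.abs_cos_le_one _)
  have hsi : Integrable fun ξ : ℝ => |ξ| * Real.exp (-a * ξ ^ 2) * Real.sin (w * ξ) :=
    habs.mul_bdd (c := 1) (by fun_prop) (Eventually.of_forall fun ξ => Real.abs_sin_le_one _)
  have hpt : ∀ ξ : ℝ, Complex.exp (↑(-2 * Real.pi * ξ * x) * Complex.I) •
      ((|ξ| * Real.exp (-a * ξ ^ 2) : ℝ) : ℂ) =
      ((|ξ| * Real.exp (-a * ξ ^ 2) * Real.cos (w * ξ) : ℝ) : ℂ) -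
        ((|ξ| * Real.exp (-a * ξ ^ 2) * Real.sin (w * ξ) : ℝ) : ℂ) * Complex.I := by
    intro ξ
    rw [show -2 * Real.pi * ξ * x = -(w * ξ) by rw [hw]; ring, Complex.exp_mul_I,
      ← Complex.ofReal_cos, ← Complex.ofReal_sin, Real.cos_neg, Real.sin_neg, smul_eq_mul]
    push_cast
    ring
  rw [Real.fourier_real_eq_integral_exp_smul]
  simp_rw [hpt]
  rw [integral_sub hci.ofReal (hsi.ofReal.mul_const _), integral_mul_const, integral_complex_ofReal,
    integral_complex_ofReal, integral_eq_zero_of_odd (f := fun ξ =>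
      |ξ| * Real.exp (-a * ξ ^ 2) * Real.sin (w * ξ)) (fun ξ => by simp), Complex.ofReal_zero,
    zero_mul, sub_zero]
  congr 1
  have heven : (∫ ξ : ℝ, |ξ| * Real.exp (-a * ξ ^ 2) * Real.cos (w * ξ)) =
      2 * ∫ ξ in Set.Ioi (0 : ℝ), ξ * Real.exp (-a * ξ ^ 2) * Real.cos (w * ξ) := by
    rw [← integral_comp_abs]
    refine integral_congr_ae (Eventually.of_forall fun ξ => ?_)
    rcases abs_cases ξ with ⟨h, _⟩ | ⟨h, _⟩ <;> simp [h]
  -- The transform is twice the cosine integral, which the differential equation expresses through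
  -- the sine integral.
  have h1 := integral_Ioi_mul_exp_neg_mul_sq_mul_cos ha w
  have hw2 : w ^ 2 / (4 * a) = Real.pi ^ 2 * x ^ 2 / a := by rw [hw]; field_simp; ring
  rw [integral_Ioi_exp_neg_mul_sq_mul_sin ha, hw2] at h1
  rw [heven]
  generalize (∫ s in (0 : ℝ)..1, Real.exp (-(Real.pi ^ 2 * x ^ 2 / a * (1 - s ^ 2)))) = I at *
  generalize (∫ ξ in Set.Ioi (0 : ℝ), ξ * Real.exp (-a * ξ ^ 2) * Real.cos (w * ξ)) = c at *
  rw [← hw2]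
  field_simp at h1 ⊢
  linarith

/-! ### Oscillatory integrals over half-lines -/

section HalfLine

variable (h : 𝓢(ℝ, ℂ)) {w : ℝ}

theorem norm_exp_ofReal_mul_I_mul (w ξ : ℝ) : ‖Complex.exp (w * ξ * Complex.I)‖ = 1 := by
  rw [← Complex.ofReal_mul, Complex.norm_exp_ofReal_mul_I]

theorem SchwartzMap.integrable_mul_exp (h : 𝓢(ℝ, ℂ)) (w : ℝ) :
    Integrable fun ξ : ℝ => h ξ * Complex.exp (w * ξ * Complex.I) :=
  h.integrable.mul_bdd (c := 1) (by fun_prop)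
    (Eventually.of_forall fun ξ => (norm_exp_ofReal_mul_I_mul w ξ).le)

/-- An antiderivative of `(h + h''/w²) exp (iwξ)`. -/
noncomputable def oscillatoryPrimitive (w ξ : ℝ) : ℂ :=
  (h ξ / (w * Complex.I) + SchwartzMap.derivCLM ℂ ℂ h ξ / w ^ 2) * Complex.exp (w * ξ * Complex.I)

theorem hasDerivAt_oscillatoryPrimitive (hw : w ≠ 0) (ξ : ℝ) :
    HasDerivAt (oscillatoryPrimitive h w)
      (h ξ * Complex.exp (w * ξ * Complex.I) +
        SchwartzMap.derivCLM ℂ ℂ (SchwartzMap.derivCLM ℂ ℂ h) ξ *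
          Complex.exp (w * ξ * Complex.I) / w ^ 2) ξ := by
  have hw' : (w : ℂ) ≠ 0 := Complex.ofReal_ne_zero.mpr hw
  have hd : ∀ k : 𝓢(ℝ, ℂ), HasDerivAt k (SchwartzMap.derivCLM ℂ ℂ k ξ) ξ := fun k => by
    rw [SchwartzMap.derivCLM_apply]
    exact k.differentiableAt.hasDerivAt
  have he : HasDerivAt (fun ξ : ℝ => (w : ℂ) * ξ * Complex.I) (w * Complex.I) ξ := by
    simpa using ((hasDerivAt_id ξ).ofReal_comp.const_mul (w : ℂ)).mul_const Complex.I
  refine ((((hd h).div_const _).add ((hd (SchwartzMap.derivCLM ℂ ℂ h)).div_const _)).mul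
    he.cexp).congr_deriv ?_
  simp only [Pi.add_apply]
  field_simp
  linear_combination (SchwartzMap.derivCLM ℂ ℂ h ξ) * w * Complex.I_sq

theorem tendsto_oscillatoryPrimitive (w : ℝ) :
    Tendsto (oscillatoryPrimitive h w) (cocompact ℝ) (𝓝 0) := by
  have h1 : Tendsto (fun ξ : ℝ => h ξ / (w * Complex.I) +
      SchwartzMap.derivCLM ℂ ℂ h ξ / (w : ℂ) ^ 2) (cocompact ℝ) (𝓝 0) := by
    simpa using (h.tendsto_cocompact.div_const _).add
      ((SchwartzMap.derivCLM ℂ ℂ h).tendsto_cocompact.div_const _)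
  refine squeeze_zero_norm (fun ξ => ?_) (tendsto_norm_zero.comp h1)
  rw [oscillatoryPrimitive, norm_mul, norm_exp_ofReal_mul_I_mul, mul_one]
  rfl

theorem integrable_deriv_oscillatoryPrimitive (w : ℝ) :
    Integrable fun ξ : ℝ => h ξ * Complex.exp (w * ξ * Complex.I) +
        SchwartzMap.derivCLM ℂ ℂ (SchwartzMap.derivCLM ℂ ℂ h) ξ *
          Complex.exp (w * ξ * Complex.I) / w ^ 2 :=
  (h.integrable_mul_exp w).add
    (((SchwartzMap.derivCLM ℂ ℂ (SchwartzMap.derivCLM ℂ ℂ h)).integrable_mul_exp w).div_const _)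

/-- If `h 0 = 0`, the Fourier integral of `sign ξ • h ξ` decays quadratically. -/
theorem norm_integral_Ioi_sub_integral_Iic_le (h0 : h 0 = 0) (hw : w ≠ 0) :
    ‖(∫ ξ in Set.Ioi (0 : ℝ), h ξ * Complex.exp (w * ξ * Complex.I)) -
      ∫ ξ in Set.Iic (0 : ℝ), h ξ * Complex.exp (w * ξ * Complex.I)‖ * w ^ 2 ≤
      2 * ‖SchwartzMap.derivCLM ℂ ℂ h 0‖ +
        2 * ∫ ξ, ‖SchwartzMap.derivCLM ℂ ℂ (SchwartzMap.derivCLM ℂ ℂ h) ξ‖ := by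
  have hw' : (w : ℂ) ≠ 0 := Complex.ofReal_ne_zero.mpr hw
  set k := SchwartzMap.derivCLM ℂ ℂ (SchwartzMap.derivCLM ℂ ℂ h)
  have hI := integrable_deriv_oscillatoryPrimitive h w
  have hh := h.integrable_mul_exp w
  have hk := k.integrable_mul_exp w
  -- The hypothesis `h 0 = 0` removes the boundary term of order `1/w`.
  have e0 : oscillatoryPrimitive h w 0 = SchwartzMap.derivCLM ℂ ℂ h 0 / w ^ 2 := by
    simp [oscillatoryPrimitive, h0]
  have h1 := integral_Ioi_of_hasDerivAt_of_tendsto'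
    (fun ξ _ => hasDerivAt_oscillatoryPrimitive h hw ξ) hI.integrableOn
    ((tendsto_oscillatoryPrimitive h w).mono_left atTop_le_cocompact) (a := 0)
  have h2 := integral_Iic_of_hasDerivAt_of_tendsto'
    (fun ξ _ => hasDerivAt_oscillatoryPrimitive h hw ξ) hI.integrableOn
    ((tendsto_oscillatoryPrimitive h w).mono_left atBot_le_cocompact) (a := 0)
  rw [integral_add hh.integrableOn (hk.div_const _).integrableOn, integral_div, e0] at h1 h2
  have hb : ∀ s : Set ℝ, ‖∫ ξ in s, k ξ * Complex.exp (w * ξ * Complex.I)‖ ≤ ∫ ξ, ‖k ξ‖ := by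
    intro s
    refine (norm_integral_le_integral_norm _).trans ?_
    refine (setIntegral_le_integral hk.norm (Eventually.of_forall fun ξ => norm_nonneg _)).trans ?_
    refine (integral_congr_ae (Eventually.of_forall fun ξ => ?_)).le
    simp only [norm_mul, norm_exp_ofReal_mul_I_mul, mul_one]
  have key : ((∫ ξ in Set.Ioi (0 : ℝ), h ξ * Complex.exp (w * ξ * Complex.I)) -
      ∫ ξ in Set.Iic (0 : ℝ), h ξ * Complex.exp (w * ξ * Complex.I)) * w ^ 2 =
      -2 * SchwartzMap.derivCLM ℂ ℂ h 0 -
        (∫ ξ in Set.Ioi (0 : ℝ), k ξ * Complex.exp (w * ξ * Complex.I)) +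
        ∫ ξ in Set.Iic (0 : ℝ), k ξ * Complex.exp (w * ξ * Complex.I) := by
    rw [eq_sub_of_add_eq h1, eq_sub_of_add_eq h2]
    generalize (∫ ξ in Set.Ioi (0 : ℝ), k ξ * Complex.exp (w * ξ * Complex.I)) = p
    generalize (∫ ξ in Set.Iic (0 : ℝ), k ξ * Complex.exp (w * ξ * Complex.I)) = q
    field_simp
    ring
  have hn : ‖(w : ℂ) ^ 2‖ = w ^ 2 := by
    rw [norm_pow, Complex.norm_real, Real.norm_eq_abs, sq_abs]
  rw [← hn, ← norm_mul, key]
  refine (norm_add_le _ _).trans ((add_le_add_left (norm_sub_le _ _) _).trans ?_)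
  rw [norm_mul]
  have := hb (Set.Ioi 0)
  have := hb (Set.Iic 0)
  norm_num
  linarith

end HalfLine

/-! ### Continuity and decay of `√(-d²/dx²) φ` -/

section SqrtNegLaplacian

variable (φ : 𝓢(ℝ, ℂ))

theorem integrable_symbol_mul_fourier :
    Integrable fun ξ : ℝ => ((2 * Real.pi * |ξ| : ℝ) : ℂ) * 𝓕 (φ : ℝ → ℂ) ξ := by
  rw [← SchwartzMap.fourier_coe]
  have h := (SchwartzMap.smulLeftCLM ℂ (fun ξ : ℝ => ξ) (𝓕 φ)).integrable (μ := volume)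
  rw [SchwartzMap.smulLeftCLM_apply (by fun_prop)] at h
  refine (h.norm.const_mul (2 * Real.pi)).mono
    (Continuous.aestronglyMeasurable (by fun_prop)) (Eventually.of_forall fun ξ => ?_)
  simp only [norm_mul, norm_smul, Complex.norm_real, Real.norm_eq_abs, abs_abs, abs_norm]
  rw [mul_assoc]

theorem continuous_sqrtNegLaplacian : Continuous (sqrtNegLaplacian φ) := by
  have := VectorFourier.fourierIntegral_continuous (L := -innerₗ ℝ) Real.continuous_fourierChar
    (continuous_inner (𝕜 := ℝ) (E := ℝ)).neg (integrable_symbol_mul_fourier φ)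
  exact this

theorem norm_sqrtNegLaplacian_le (x : ℝ) :
    ‖sqrtNegLaplacian φ x‖ ≤ ∫ ξ : ℝ, ‖((2 * Real.pi * |ξ| : ℝ) : ℂ) * 𝓕 (φ : ℝ → ℂ) ξ‖ :=
  VectorFourier.norm_fourierIntegral_le_integral_norm _ _ (-innerₗ ℝ) _ x

theorem exists_norm_sqrtNegLaplacian_mul_sq_le :
    ∃ C : ℝ, ∀ x : ℝ, ‖sqrtNegLaplacian φ x‖ * x ^ 2 ≤ C := by
  -- Write `|ξ| 𝓕φ = sign ξ · h` with `h = ξ 𝓕φ` Schwartz and zero at the origin, so that the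
  -- half-line estimate applies.
  set h := SchwartzMap.smulLeftCLM ℂ (fun ξ : ℝ => ξ) (𝓕 φ)
  have hh : ∀ ξ, h ξ = (ξ : ℂ) * 𝓕 (φ : ℝ → ℂ) ξ := fun ξ => by
    rw [← SchwartzMap.fourier_coe]
    simp only [h, SchwartzMap.smulLeftCLM_apply (g := fun ξ : ℝ => ξ) (by fun_prop)]
    exact Complex.real_smul
  set C := 2 * ‖SchwartzMap.derivCLM ℂ ℂ h 0‖ +
        2 * ∫ ξ, ‖SchwartzMap.derivCLM ℂ ℂ (SchwartzMap.derivCLM ℂ ℂ h) ξ‖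
  have hC : 0 ≤ C := by positivity
  refine ⟨C, fun x => ?_⟩
  rcases eq_or_ne x 0 with rfl | hx
  · simpa using hC
  have hpi := Real.pi_gt_three
  have hw : 2 * Real.pi * x ≠ 0 := by positivity
  have h1 := norm_integral_Ioi_sub_integral_Iic_le h (by simp [hh]) hw
  have hin : ∀ ξ : ℝ, inner ℝ ξ x = x * ξ := fun ξ => by simp
  have heq : sqrtNegLaplacian φ x = 2 * Real.pi *
      ((∫ ξ in Set.Ioi (0 : ℝ), h ξ * Complex.exp ((2 * Real.pi * x : ℝ) * ξ * Complex.I)) -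
      ∫ ξ in Set.Iic (0 : ℝ), h ξ * Complex.exp ((2 * Real.pi * x : ℝ) * ξ * Complex.I)) := by
    have hi : Integrable fun ξ : ℝ => Complex.exp (↑(2 * Real.pi * inner ℝ ξ x) * Complex.I) •
        (((2 * Real.pi * |ξ| : ℝ) : ℂ) * 𝓕 (φ : ℝ → ℂ) ξ) := by
      refine (integrable_symbol_mul_fourier φ).bdd_mul (c := 1) ?_
        (Eventually.of_forall fun ξ => (Complex.norm_exp_ofReal_mul_I _).le)
      exact Continuous.aestronglyMeasurable (by fun_prop)
    rw [sqrtNegLaplacian, Real.fourierInv_eq',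
      ← intervalIntegral.integral_Iic_add_Ioi hi.integrableOn hi.integrableOn, mul_sub,
      sub_eq_neg_add, ← mul_neg, ← integral_neg, ← integral_const_mul, ← integral_const_mul]
    congr 1
    · refine setIntegral_congr_fun measurableSet_Iic fun ξ hξ => ?_
      simp only [hh, abs_of_nonpos (show ξ ≤ 0 from hξ), smul_eq_mul, hin]
      push_cast
      ring_nf
    · refine setIntegral_congr_fun measurableSet_Ioi fun ξ hξ => ?_
      simp only [hh, abs_of_pos (show 0 < ξ from hξ), smul_eq_mul, hin]
      push_cast
      ring_nf
  rw [heq, norm_mul]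
  have h2 : ‖(2 * Real.pi : ℂ)‖ = 2 * Real.pi := by
    rw [show (2 * Real.pi : ℂ) = ((2 * Real.pi : ℝ) : ℂ) by push_cast; rfl, Complex.norm_real,
      Real.norm_of_nonneg (by positivity)]
  rw [h2]
  generalize ‖(∫ ξ in Set.Ioi (0 : ℝ), h ξ * Complex.exp ((2 * Real.pi * x : ℝ) * ξ * Complex.I)) -
      ∫ ξ in Set.Iic (0 : ℝ), h ξ * Complex.exp ((2 * Real.pi * x : ℝ) * ξ * Complex.I)‖ = N at *
  have h3 : N * (2 * Real.pi * x) ^ 2 = 2 * Real.pi * (2 * Real.pi * N * x ^ 2) := by ring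
  rw [h3] at h1
  by_contra! hlt
  nlinarith

theorem integrable_sqrtNegLaplacian : Integrable (sqrtNegLaplacian φ) := by
  obtain ⟨C, hC⟩ := exists_norm_sqrtNegLaplacian_mul_sq_le φ
  set C' := ∫ ξ : ℝ, ‖((2 * Real.pi * |ξ| : ℝ) : ℂ) * 𝓕 (φ : ℝ → ℂ) ξ‖
  refine (integrable_inv_one_add_sq.const_mul (C' + C)).mono'
    (continuous_sqrtNegLaplacian φ).aestronglyMeasurable (Eventually.of_forall fun x => ?_)
  rw [← div_eq_mul_inv, le_div_iff₀ (by positivity)]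
  linarith [norm_sqrtNegLaplacian_le φ x, hC x]

end SqrtNegLaplacian

/-! ### The identity for a single Gaussian -/

/-- `√(-d²/dx²) exp (-tx²)`, as a function of `t` and `x`. -/
noncomputable def gaussianKernel (t x : ℝ) : ℝ :=
  2 * √t / √Real.pi *
    (1 - 2 * (t * x ^ 2) * ∫ s in (0 : ℝ)..1, Real.exp (-(t * x ^ 2 * (1 - s ^ 2))))

/-- The Fourier transform of `√(-d²/dx²) exp (-tx²)`. -/
noncomputable def gaussianSymbol (t ξ : ℝ) : ℝ :=
  2 * Real.pi * √(Real.pi / t) * (|ξ| * Real.exp (-(Real.pi ^ 2 / t) * ξ ^ 2))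

theorem integrable_gaussianSymbol {t : ℝ} (ht : 0 < t) : Integrable (gaussianSymbol t) := by
  have ha : 0 < Real.pi ^ 2 / t := by positivity
  refine ((integrable_mul_exp_neg_mul_sq ha).norm.congr
    (Eventually.of_forall fun ξ => ?_)).const_mul (2 * Real.pi * √(Real.pi / t))
  simp

theorem fourier_gaussianSymbol {t : ℝ} (ht : 0 < t) (x : ℝ) :
    𝓕 (fun ξ : ℝ => (gaussianSymbol t ξ : ℂ)) x = gaussianKernel t x := by
  have ha : 0 < Real.pi ^ 2 / t := by positivity
  have h := fourier_abs_mul_exp_neg_mul_sq ha x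
  have hmul : ∀ ξ : ℝ, (gaussianSymbol t ξ : ℂ) = ((2 * Real.pi * √(Real.pi / t) : ℝ) : ℂ) *
      ((|ξ| * Real.exp (-(Real.pi ^ 2 / t) * ξ ^ 2) : ℝ) : ℂ) := fun ξ => by
    rw [← Complex.ofReal_mul, gaussianSymbol]
  rw [Real.fourier_real_eq_integral_exp_smul] at h ⊢
  simp only [smul_eq_mul] at h ⊢
  simp only [hmul, mul_left_comm (Complex.exp _)]
  rw [integral_const_mul, h, ← Complex.ofReal_mul, gaussianKernel]
  congr 1
  have hz : Real.pi ^ 2 * x ^ 2 / (Real.pi ^ 2 / t) = t * x ^ 2 := by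
    field_simp
  rw [hz, ← mul_assoc]
  congr 1
  have h1 : √Real.pi ^ 2 = Real.pi := Real.sq_sqrt Real.pi_pos.le
  have h2 : √t ^ 2 = t := Real.sq_sqrt ht.le
  have h3 : 0 < √Real.pi := Real.sqrt_pos.mpr Real.pi_pos
  have h4 : 0 < √t := Real.sqrt_pos.mpr ht
  rw [Real.sqrt_div Real.pi_pos.le]
  generalize √Real.pi = p at *
  generalize √t = r at *
  rw [← h1, ← h2]
  field_simp

/-- The symbol is nonnegative, so its transform is largest at `x = 0`, where the value is explicit.
-/
theorem norm_gaussianKernel_le {t : ℝ} (ht : 0 < t) (x : ℝ) :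
    ‖gaussianKernel t x‖ ≤ 2 * √t / √Real.pi := by
  have h0 : (∫ ξ, gaussianSymbol t ξ) = 2 * √t / √Real.pi := by
    have h := fourier_gaussianSymbol ht 0
    rw [Real.fourier_real_eq_integral_exp_smul] at h
    simp only [mul_zero, Complex.ofReal_zero, zero_mul, Complex.exp_zero, one_smul] at h
    rw [integral_complex_ofReal, Complex.ofReal_inj] at h
    rw [h]
    simp [gaussianKernel]
  rw [← h0, ← Complex.norm_real, ← fourier_gaussianSymbol ht]
  refine (VectorFourier.norm_fourierIntegral_le_integral_norm _ _ _ _ _).trans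
    (integral_congr_ae (Eventually.of_forall fun ξ => ?_)).le
  simp only [Complex.norm_real]
  exact Real.norm_of_nonneg (by rw [gaussianSymbol]; positivity)

theorem continuous_gaussianKernel : Continuous fun p : ℝ × ℝ => gaussianKernel p.1 p.2 := by
  have h : Continuous fun p : ℝ × ℝ =>
      ∫ s in (0 : ℝ)..1, Real.exp (-(p.1 * p.2 ^ 2 * (1 - s ^ 2))) :=
    intervalIntegral.continuous_parametric_intervalIntegral_of_continuous'
      (f := fun (p : ℝ × ℝ) s => Real.exp (-(p.1 * p.2 ^ 2 * (1 - s ^ 2)))) (by fun_prop) 0 1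
  unfold gaussianKernel
  fun_prop

theorem integral_fourier_mul_eq_integral_mul_fourier {f g : ℝ → ℂ} (hf : Integrable f)
    (hg : Integrable g) : ∫ x, 𝓕 f x * g x = ∫ x, f x * 𝓕 g x := by
  have := VectorFourier.integral_fourierIntegral_smul_eq_flip (L := innerₗ ℝ)
    Real.continuous_fourierChar (continuous_inner (𝕜 := ℝ) (E := ℝ)) hf hg
  rw [flip_innerₗ] at this
  exact this

theorem fourier_exp_neg_mul_sq {t : ℝ} (ht : 0 < t) (ξ : ℝ) :
    𝓕 (fun x : ℝ => ((Real.exp (-(t * x ^ 2)) : ℝ) : ℂ)) ξ =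
      ((√(Real.pi / t) * Real.exp (-(Real.pi ^ 2 / t) * ξ ^ 2) : ℝ) : ℂ) := by
  have hpi : (Real.pi : ℂ) ≠ 0 := Complex.ofReal_ne_zero.mpr Real.pi_ne_zero
  have hb : 0 < ((t / Real.pi : ℝ) : ℂ).re := by
    rw [Complex.ofReal_re]; positivity
  have h := congr_fun (fourier_gaussian_pi hb) ξ
  have hf : (fun x : ℝ => ((Real.exp (-(t * x ^ 2)) : ℝ) : ℂ)) =
      fun x : ℝ => Complex.exp (-Real.pi * ((t / Real.pi : ℝ) : ℂ) * x ^ 2) := by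
    ext x
    push_cast
    congr 1
    field_simp
  rw [hf, h, Complex.ofReal_mul, Real.sqrt_eq_rpow, Complex.ofReal_cpow (by positivity)]
  congr 1
  · rw [← Complex.ofReal_one, ← Complex.ofReal_ofNat, ← Complex.ofReal_div,
      ← Complex.ofReal_cpow (by positivity), ← Complex.ofReal_div, ← Complex.ofReal_cpow
      (by positivity), ← inv_div t, Real.inv_rpow (by positivity), one_div]
  · push_cast
    congr 1
    field_simp

/-- Two transfers of the Fourier transform across the pairing move the multiplier `|k|` from `φ` to
the Gaussian. -/
theorem integral_exp_neg_mul_sq_mul_sqrtNegLaplacian {t : ℝ} (ht : 0 < t) (φ : 𝓢(ℝ, ℂ)) :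
    (∫ x : ℝ, ((Real.exp (-(t * x ^ 2)) : ℝ) : ℂ) * sqrtNegLaplacian φ x) =
      ∫ x : ℝ, (gaussianKernel t x : ℂ) * φ x := by
  set g : ℝ → ℂ := fun ξ => ((2 * Real.pi * |ξ| : ℝ) : ℂ) * 𝓕 (φ : ℝ → ℂ) ξ
  have hg : Integrable g := integrable_symbol_mul_fourier φ
  have hgauss : Integrable fun x : ℝ => ((Real.exp (-(t * x ^ 2)) : ℝ) : ℂ) := by
    have := integrable_exp_neg_mul_sq ht
    simp only [neg_mul] at this
    exact this.ofReal
  calc (∫ x : ℝ, ((Real.exp (-(t * x ^ 2)) : ℝ) : ℂ) * sqrtNegLaplacian φ x)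
      = ∫ x : ℝ, ((Real.exp (-(t * x ^ 2)) : ℝ) : ℂ) * 𝓕 g x := by
        -- The inverse transform is the reflected transform, and the Gaussian is even.
        rw [← integral_neg_eq_self]
        refine integral_congr_ae (Eventually.of_forall fun x => ?_)
        simp only [sqrtNegLaplacian, Real.fourierInv_eq_fourier_neg, neg_neg, neg_sq, g]
    _ = ∫ ξ : ℝ, 𝓕 (fun x : ℝ => ((Real.exp (-(t * x ^ 2)) : ℝ) : ℂ)) ξ * g ξ :=
        (integral_fourier_mul_eq_integral_mul_fourier hgauss hg).symm
    _ = ∫ ξ : ℝ, (gaussianSymbol t ξ : ℂ) * 𝓕 (φ : ℝ → ℂ) ξ := by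
        refine integral_congr_ae (Eventually.of_forall fun ξ => ?_)
        simp only [fourier_exp_neg_mul_sq ht, g, gaussianSymbol]
        push_cast
        ring
    _ = ∫ x : ℝ, 𝓕 (fun ξ : ℝ => (gaussianSymbol t ξ : ℂ)) x * φ x :=
        (integral_fourier_mul_eq_integral_mul_fourier (integrable_gaussianSymbol ht).ofReal
          φ.integrable).symm
    _ = _ := by simp only [fourier_gaussianSymbol ht]

/-! ### Superposition of Gaussians -/

theorem integrableOn_rpow_mul_exp_neg {c : ℝ} (hc : 0 < c) :
    IntegrableOn (fun t : ℝ => t ^ (c - 1) * Real.exp (-t)) (Set.Ioi 0) := by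
  simpa only [mul_comm] using Real.GammaIntegral_convergent hc

theorem integral_rpow_mul_exp_neg {c : ℝ} (hc : 0 < c) :
    ∫ t in Set.Ioi (0 : ℝ), t ^ (c - 1) * Real.exp (-t) = Real.Gamma c := by
  rw [Real.Gamma_eq_integral hc]
  simp only [mul_comm]

/-- `(1 + x²)^(-ν)` as a superposition of Gaussians. -/
theorem Gamma_mul_uFun {ν : ℝ} (hν : 0 < ν) (x : ℝ) :
    Real.Gamma ν * uFun ν x =
      ∫ t in Set.Ioi (0 : ℝ), t ^ (ν - 1) * Real.exp (-t) * Real.exp (-(t * x ^ 2)) := by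
  have hp : 0 < 1 + x ^ 2 := by positivity
  have h := Real.integral_rpow_mul_exp_neg_mul_Ioi hν hp
  rw [one_div, Real.inv_rpow hp.le, ← one_div] at h
  rw [uFun, mul_comm, ← h]
  refine setIntegral_congr_fun measurableSet_Ioi fun t _ => ?_
  rw [mul_assoc, ← Real.exp_add]
  ring_nf

/-- Fubini for a bounded kernel between integrable factors. The measure `μ` is general because both
the `x`-integral over the line and the `s`-integral over `(0, 1]` are exchanged with the
`t`-integral. -/
theorem integral_Ioi_mul_integral_swap {w : ℝ → ℝ} (hw : IntegrableOn w (Set.Ioi 0))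
    {k : ℝ → ℝ → ℝ} (hk : Measurable (Function.uncurry k)) {μ : Measure ℝ} [SFinite μ] {C : ℝ}
    (hC : ∀ᵐ x ∂μ, ∀ t : ℝ, 0 < t → ‖k t x‖ ≤ C) {φ : ℝ → ℂ} (hφ : Integrable φ μ) :
    ∫ t in Set.Ioi (0 : ℝ), (w t : ℂ) * ∫ x, (k t x : ℂ) * φ x ∂μ =
      ∫ x, ((∫ t in Set.Ioi (0 : ℝ), w t * k t x : ℝ) : ℂ) * φ x ∂μ := by
  have hint : Integrable (Function.uncurry fun t x : ℝ => (w t : ℂ) * ((k t x : ℂ) * φ x))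
      ((volume.restrict (Set.Ioi 0)).prod μ) := by
    have hw' : Integrable (fun t => (w t : ℂ)) (volume.restrict (Set.Ioi 0)) := Integrable.ofReal hw
    refine ((hw'.mul_prod hφ).bdd_mul (c := C) (f := fun p : ℝ × ℝ => (k p.1 p.2 : ℂ))
      (Complex.measurable_ofReal.comp hk).aestronglyMeasurable ?_).congr
      (Eventually.of_forall fun p => ?_)
    · filter_upwards [Measure.quasiMeasurePreserving_fst.ae (ae_restrict_mem measurableSet_Ioi),
        Measure.quasiMeasurePreserving_snd.ae hC] with p hp1 hp2
      rw [Complex.norm_real]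
      exact hp2 _ hp1
    · simp only [Function.uncurry]
      ring
  calc ∫ t in Set.Ioi (0 : ℝ), (w t : ℂ) * ∫ x, (k t x : ℂ) * φ x ∂μ
      = ∫ t in Set.Ioi (0 : ℝ), ∫ x, (w t : ℂ) * ((k t x : ℂ) * φ x) ∂μ := by
        simp only [integral_const_mul]
    _ = ∫ x, (∫ t in Set.Ioi (0 : ℝ), (w t : ℂ) * ((k t x : ℂ) * φ x)) ∂μ :=
        integral_integral_swap hint
    _ = _ := by
        refine integral_congr_ae (Eventually.of_forall fun x => ?_)
        simp only [← mul_assoc, integral_mul_const, ← integral_complex_ofReal, Complex.ofReal_mul]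

theorem integral_uFun_mul_sqrtNegLaplacian {ν : ℝ} (hν : 0 < ν) (φ : 𝓢(ℝ, ℂ)) :
    (Real.Gamma ν : ℂ) * ∫ x : ℝ, (uFun ν x : ℂ) * sqrtNegLaplacian φ x =
      ∫ t in Set.Ioi (0 : ℝ), ((t ^ (ν - 1) * Real.exp (-t) : ℝ) : ℂ) *
        ∫ x : ℝ, ((Real.exp (-(t * x ^ 2)) : ℝ) : ℂ) * sqrtNegLaplacian φ x := by
  rw [integral_Ioi_mul_integral_swap (integrableOn_rpow_mul_exp_neg hν)
    (k := fun t x => Real.exp (-(t * x ^ 2))) (C := 1) (by unfold Function.uncurry; fun_prop)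
    (Eventually.of_forall fun x t ht => ?_) (integrable_sqrtNegLaplacian φ), ← integral_const_mul]
  · refine integral_congr_ae (Eventually.of_forall fun x => ?_)
    simp only
    rw [← Gamma_mul_uFun hν, ← mul_assoc, Complex.ofReal_mul]
  · rw [Real.norm_of_nonneg (Real.exp_pos _).le, Real.exp_le_one_iff]
    have := mul_nonneg ht.le (sq_nonneg x)
    linarith

theorem integral_Ioi_rpow_mul_integral_exp {b : ℝ} (hb : 0 < b) (x : ℝ) :
    ∫ t in Set.Ioi (0 : ℝ), t ^ b * Real.exp (-t) *
        ∫ s in (0 : ℝ)..1, Real.exp (-(t * x ^ 2 * (1 - s ^ 2))) =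
      b * Real.Gamma b *
        ∫ s in (0 : ℝ)..1, (1 + x ^ 2 * (1 - s ^ 2)) ^ (-(b + 1)) := by
  have h := integral_Ioi_mul_integral_swap (μ := volume.restrict (Set.Ioc 0 1))
    (φ := fun _ => 1) (C := 1) (k := fun t s => Real.exp (-(t * x ^ 2 * (1 - s ^ 2))))
    (integrableOn_rpow_mul_exp_neg (c := b + 1) (by linarith))
    (by unfold Function.uncurry; fun_prop) ?_ (integrable_const _)
  · simp only [mul_one, integral_complex_ofReal, ← Complex.ofReal_mul, Complex.ofReal_inj,
      add_sub_cancel_right] at h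
    simp only [intervalIntegral.integral_of_le zero_le_one]
    rw [h, ← integral_const_mul]
    refine setIntegral_congr_fun measurableSet_Ioc fun s hs => ?_
    have hp := one_add_mul_pos (x := x) (Set.Ioc_subset_Icc_self hs)
    have hG := Real.integral_rpow_mul_exp_neg_mul_Ioi (a := b + 1) (by linarith) hp
    rw [one_div, Real.inv_rpow hp.le, ← Real.rpow_neg hp.le, Real.Gamma_add_one hb.ne',
      add_sub_cancel_right] at hG
    rw [mul_comm, ← hG]
    refine setIntegral_congr_fun measurableSet_Ioi fun t _ => ?_
    rw [mul_assoc, ← Real.exp_add]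
    ring_nf
  · filter_upwards [ae_restrict_mem measurableSet_Ioc] with s hs t ht
    rw [Real.norm_of_nonneg (Real.exp_pos _).le, Real.exp_le_one_iff]
    have h1 : 0 ≤ 1 - s ^ 2 := by nlinarith [hs.1, hs.2]
    have := mul_nonneg (mul_nonneg (le_of_lt ht) (sq_nonneg x)) h1
    linarith

/-- The factor `√t` of the kernel raises the exponent `ν - 1` to `b - 1`; the two terms then give
Gamma integrals at `b` and `b + 1`, and `Γ(b+1) = bΓ(b)`. -/
theorem integral_rpow_mul_exp_neg_mul_gaussianKernel {ν : ℝ} (hν : 0 < ν) (x : ℝ) :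
    ∫ t in Set.Ioi (0 : ℝ), t ^ (ν - 1) * Real.exp (-t) * gaussianKernel t x =
      2 / √Real.pi * Real.Gamma (1 / 2 + ν) * eulerIntegral (1 / 2 + ν) (-x ^ 2) := by
  have hb : 0 < 1 / 2 + ν := by linarith
  set b := 1 / 2 + ν with hbdef
  set J : ℝ → ℝ := fun t => ∫ s in (0 : ℝ)..1, Real.exp (-(t * x ^ 2 * (1 - s ^ 2)))
  have hJc : Continuous J :=
    intervalIntegral.continuous_parametric_intervalIntegral_of_continuous'
      (f := fun t s => Real.exp (-(t * x ^ 2 * (1 - s ^ 2)))) (by fun_prop) 0 1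
  have hJb : ∀ t : ℝ, 0 < t → ‖J t‖ ≤ 1 := fun t ht => by
    have := intervalIntegral.norm_integral_le_of_norm_le_const (a := 0) (b := 1) (C := 1)
      (f := fun s => Real.exp (-(t * x ^ 2 * (1 - s ^ 2)))) fun s hs => by
        rw [Set.uIoc_of_le zero_le_one] at hs
        rw [Real.norm_of_nonneg (Real.exp_pos _).le, Real.exp_le_one_iff]
        have h1 : 0 ≤ 1 - s ^ 2 := by nlinarith [hs.1, hs.2]
        have := mul_nonneg (mul_nonneg (le_of_lt ht) (sq_nonneg x)) h1
        linarith
    simpa using this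
  have hi1 := integrableOn_rpow_mul_exp_neg hb
  have hi2 : IntegrableOn (fun t => t ^ b * Real.exp (-t) * J t) (Set.Ioi 0) := by
    have := integrableOn_rpow_mul_exp_neg (c := b + 1) (by linarith)
    rw [add_sub_cancel_right] at this
    exact Integrable.mul_bdd (c := 1) this hJc.aestronglyMeasurable
      ((ae_restrict_mem measurableSet_Ioi).mono hJb)
  have hpt : ∀ t ∈ Set.Ioi (0 : ℝ), t ^ (ν - 1) * Real.exp (-t) * gaussianKernel t x =
      2 / √Real.pi * (t ^ (b - 1) * Real.exp (-t) -
        2 * x ^ 2 * (t ^ b * Real.exp (-t) * J t)) := by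
    intro t ht
    have ht : 0 < t := ht
    have e1 : t ^ (ν - 1) * √t = t ^ (b - 1) := by
      rw [Real.sqrt_eq_rpow, ← Real.rpow_add ht, hbdef]
      ring_nf
    have e2 : t ^ b = t ^ (b - 1) * t := by
      rw [Real.rpow_sub_one ht.ne']
      field_simp
    rw [e2, ← e1, gaussianKernel]
    change _ * (_ * (1 - _ * J t)) = _
    ring
  rw [setIntegral_congr_fun measurableSet_Ioi hpt, integral_const_mul,
    integral_sub hi1 (hi2.const_mul _), integral_const_mul, integral_rpow_mul_exp_neg hb,
    integral_Ioi_rpow_mul_integral_exp hb, eulerIntegral_neg_sq]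
  ring

theorem Gamma_mul_VFun_mul_uFun {ν : ℝ} (hν : 0 < ν) (x : ℝ) :
    Real.Gamma ν * (VFun ν x * uFun ν x) =
      -(2 / √Real.pi * Real.Gamma (1 / 2 + ν) * eulerIntegral (1 / 2 + ν) (-x ^ 2)) := by
  have hΓ : Real.Gamma ν ≠ 0 := (Real.Gamma_pos_of_pos hν).ne'
  have hp : (1 + x ^ 2) ^ ν ≠ 0 := by positivity
  rw [VFun_eq hν, uFun]
  field_simp

theorem integral_gaussianKernel_mul {ν : ℝ} (hν : 0 < ν) (φ : 𝓢(ℝ, ℂ)) :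
    (∫ t in Set.Ioi (0 : ℝ), ((t ^ (ν - 1) * Real.exp (-t) : ℝ) : ℂ) *
        ∫ x : ℝ, (gaussianKernel t x : ℂ) * φ x) =
      -((Real.Gamma ν : ℂ) * ∫ x : ℝ, ((VFun ν x * uFun ν x : ℝ) : ℂ) * φ x) := by
  -- The bound on `gaussianKernel` grows like `√t`. Moving `√t` into the weight leaves a kernel
  -- bounded by `2/√π`, as Fubini requires.
  have hw : IntegrableOn (fun t : ℝ => t ^ (ν - 1) * Real.exp (-t) * √t) (Set.Ioi 0) := by
    refine (integrableOn_rpow_mul_exp_neg (c := ν + 1 / 2) (by linarith)).congr_fun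
      (fun t ht => ?_) measurableSet_Ioi
    have ht : 0 < t := ht
    rw [mul_right_comm, Real.sqrt_eq_rpow, ← Real.rpow_add ht]
    ring_nf
  have hk : Measurable (Function.uncurry fun t x => gaussianKernel t x / √t) :=
    continuous_gaussianKernel.measurable.div (by fun_prop)
  have h := integral_Ioi_mul_integral_swap hw hk (C := 2 / √Real.pi)
    (Eventually.of_forall fun x t ht => ?_) φ.integrable (μ := volume)
  · have e1 : ∀ t ∈ Set.Ioi (0 : ℝ),
        ((t ^ (ν - 1) * Real.exp (-t) * √t : ℝ) : ℂ) *
          ∫ x : ℝ, ((gaussianKernel t x / √t : ℝ) : ℂ) * φ x =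
        ((t ^ (ν - 1) * Real.exp (-t) : ℝ) : ℂ) * ∫ x : ℝ, (gaussianKernel t x : ℂ) * φ x := by
      intro t ht
      have hs : (√t : ℂ) ≠ 0 := Complex.ofReal_ne_zero.mpr (Real.sqrt_pos.mpr ht).ne'
      rw [Complex.ofReal_mul _ √t, mul_assoc, ← integral_const_mul (√t : ℂ)]
      congr 2
      ext x
      push_cast
      field_simp
    have e2 : ∀ x : ℝ, (∫ t in Set.Ioi (0 : ℝ), t ^ (ν - 1) * Real.exp (-t) * √t *
        (gaussianKernel t x / √t)) = -(Real.Gamma ν * (VFun ν x * uFun ν x)) := fun x => by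
      rw [Gamma_mul_VFun_mul_uFun hν, neg_neg, ← integral_rpow_mul_exp_neg_mul_gaussianKernel hν]
      refine setIntegral_congr_fun measurableSet_Ioi fun t ht => ?_
      have hs : √t ≠ 0 := (Real.sqrt_pos.mpr ht).ne'
      field_simp
    rw [setIntegral_congr_fun measurableSet_Ioi e1] at h
    rw [h, ← integral_const_mul, ← integral_neg]
    refine integral_congr_ae (Eventually.of_forall fun x => ?_)
    simp only [e2]
    push_cast
    ring
  · have hs : 0 < √t := Real.sqrt_pos.mpr ht
    rw [norm_div, Real.norm_of_nonneg hs.le, div_le_iff₀ hs]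
    refine (norm_gaussianKernel_le ht x).trans (le_of_eq ?_)
    ring

/-! ### The zero-energy equation and the final statement -/

theorem isZeroEnergySolution_VFun_uFun {ν : ℝ} (hν : 0 < ν) :
    IsZeroEnergySolution (VFun ν) (uFun ν) := by
  intro φ
  have hΓ : 0 < Real.Gamma ν := Real.Gamma_pos_of_pos hν
  have hb : 0 < 1 / 2 + ν := by linarith
  refine ⟨?_, ?_, ?_⟩
  · have hu : Continuous (uFun ν) := by
      unfold uFun
      refine continuous_const.div ?_ fun x => by positivity
      exact Continuous.rpow_const (by fun_prop) fun x => Or.inl (by positivity)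
    refine (integrable_sqrtNegLaplacian φ).bdd_mul (c := 1)
      (Complex.continuous_ofReal.comp hu).aestronglyMeasurable (Eventually.of_forall fun x => ?_)
    rw [Complex.norm_real, uFun, Real.norm_of_nonneg (by positivity)]
    exact div_le_one_of_le₀ (Real.one_le_rpow (by nlinarith [sq_nonneg x]) hν.le) (by positivity)
  · have hV : ∀ x, VFun ν x * uFun ν x =
        -(2 / √Real.pi * Real.Gamma (1 / 2 + ν) / Real.Gamma ν) *
          eulerIntegral (1 / 2 + ν) (-x ^ 2) := fun x => by
      have h := Gamma_mul_VFun_mul_uFun hν x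
      field_simp at h ⊢
      linarith
    simp only [hV]
    refine φ.integrable.bdd_mul
      (c := |-(2 / √Real.pi * Real.Gamma (1 / 2 + ν) / Real.Gamma ν)| * (1 + 2 * (1 / 2 + ν)))
      (Complex.continuous_ofReal.comp (continuous_const.mul
        (continuous_eulerIntegral_neg_sq hb.le))).aestronglyMeasurable
      (Eventually.of_forall fun x => ?_)
    rw [Complex.norm_real, norm_mul]
    exact mul_le_mul_of_nonneg_left (abs_eulerIntegral_neg_sq_le_const hb x) (abs_nonneg _)
  · have h1 := integral_uFun_mul_sqrtNegLaplacian hν φ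
    have h2 := integral_gaussianKernel_mul hν φ
    have h3 : (∫ t in Set.Ioi (0 : ℝ), ((t ^ (ν - 1) * Real.exp (-t) : ℝ) : ℂ) *
        ∫ x : ℝ, ((Real.exp (-(t * x ^ 2)) : ℝ) : ℂ) * sqrtNegLaplacian φ x) =
        ∫ t in Set.Ioi (0 : ℝ), ((t ^ (ν - 1) * Real.exp (-t) : ℝ) : ℂ) *
        ∫ x : ℝ, (gaussianKernel t x : ℂ) * φ x :=
      setIntegral_congr_fun measurableSet_Ioi fun t ht => by
        simp only [integral_exp_neg_mul_sq_mul_sqrtNegLaplacian ht]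
    rw [h3, h2] at h1
    have hΓ' : (Real.Gamma ν : ℂ) ≠ 0 := Complex.ofReal_ne_zero.mpr hΓ.ne'
    refine (mul_eq_zero.mp ?_).resolve_left hΓ'
    rw [mul_add, h1, neg_add_cancel]

theorem theorem4 (ν : ℝ) (hν : 0 < ν) :
    IsZeroEnergySolution (VFun ν) (uFun ν) ∧
    (ν < 1 / 2 → VFun ν =O[cocompact ℝ] fun x : ℝ => 1 / |x|) ∧
    (ν = 1 / 2 →
      (∀ x : ℝ, uFun ν x = 1 / √(1 + x ^ 2)) ∧
      (∀ x : ℝ, VFun ν x =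
        -(2 / Real.pi) * (1 / √(1 + x ^ 2) - |x| * Real.arsinh |x| / (1 + x ^ 2))) ∧
      VFun ν =O[cocompact ℝ] fun x : ℝ => Real.log |x| / |x|) ∧
    (1 / 2 < ν → ν < 1 → VFun ν =O[cocompact ℝ] fun x : ℝ => 1 / |x| ^ (2 - 2 * ν)) := by
  refine ⟨isZeroEnergySolution_VFun_uFun hν, isBigO_VFun_of_lt_half hν, ?_,
    fun h _ => isBigO_VFun_of_half_lt h⟩
  rintro rfl
  exact ⟨uFun_half, VFun_half, isBigO_VFun_half⟩
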